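/- **Setting.** For $n\ge 0$ let $F=(F_1,\dots,F_{8n})$ be independent uniformly random functions $F_i:\{0,1\}^n\to\{0,1\}^n$, and let $R=((a_i,b_i))_{1\le i\le 8n}$ be uniform in $(\mathrm{GL}_n(\mathbb F_2)\times\mathbb F_2^n)^{8n}$. A *subversion algorithm* $\mathcal A$ is a deterministic algorithm with oracle access to $F$ that computes a value $\tilde F_i(x)$ on each input $(i,x)$; it is $(q,\epsilon)$-*admissible* if it makes at most $q$ queries on each input and, for every $F$ and $i$, $\Pr_x[\tilde F_i(x)\ne F_i(x)]\le\epsilon$. The construction is the $8n$-round Feistel permutation $C^{\tilde F}(R):(x_0,x_1)\mapsto(x_{8n},x_{8n+1})$, $x_{i+1}=x_{i-1}\oplus\tilde F_i(a_ix_i\oplus b_i)$. The ideal object is a uniformly random permutation $P$ of $\{0,1\}^{2n}$. Permutations can be queried in both directions. Adversaries may be randomized and are bounded only by their numbers of queries. *Abbreviated model.* For $(\mathcal D,\mathcal A)$ fixed in advance, $\mathcal D$ receives $R$, queries either $(C^{\tilde F}(R),F)$ or $(P,\mathcal S^P(R,\mathcal A))$, and outputs a bit. *Full model.* $\mathcal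 D$ first queries $F$ (in the ideal world: the simulator, which does not yet know $R$ or $\mathcal A$), then publishes $\mathcal A$; then $R$ is drawn and given to $\mathcal D$ and, with $\mathcal A$, to the simulator; then $\mathcal D$, keeping its state, queries either $(C^{\tilde F}(R),F)$ or $(P,\text{simulator}^P)$ and outputs a bit. A simulator may abort the game, which counts as not outputting $1$. Let $q_{\mathcal D},q_{\mathcal A}:\mathbb N\to\mathbb N$ and $\epsilon,\epsilon':\mathbb N\to\mathbb R$. The construction is *(abbreviated-)crooked-indifferentiable from $P$ by means of a simulator, with parameters $(q_{\mathcal D},q_{\mathcal A},\epsilon,\epsilon')$*, if for all $n$, all $\mathcal D$ making at most $q_{\mathcal D}(n)$ queries in total and all $(q_{\mathcal A}(n),\epsilon(n))$-admissible $\mathcal A$ (in the full model: all $\mathcal D$ that always publish such an $\mathcal A$), the probabilities that $\mathcal D$ outputs $1$ in the two worlds differ by at most $\epsilon'(n)$, and the simulator is efficient: there are a polynomial $p$ and a negligible $\nu$ such that for all these $n$ and adversaries it makes more than $p(n+q_{\mathcal D}(n)+q_{\mathcal A}(n))$ steps with probability at most $\nu(n)$ (one step is a table access, an operation on $n$-bit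 strings, an oracle call, or a simulated step of $\mathcal A$ up to its next query). *The simulator $\mathcal S$.* Write $CF_i(x)=F_i(a_ix\oplus b_i)$, $C\tilde F_i(x)=\tilde F_i(a_ix\oplus b_i)$ and $\lambda=\max(2,\lceil n/10\rceil)$. $\mathcal S$ keeps a table of values of $CF$. An unsubverted chain is a sequence $x_s,\dots,x_{s+r}$ with all $CF_i(x_i)$ in the table and $x_{i+1}=x_{i-1}\oplus CF_i(x_i)$ for $s<i<s+r$. A value that is needed and missing is drawn uniformly, and all unsubverted chains of length $\lambda$ which begin or end at the new term are put in a FIFO queue. After a query, $\mathcal S$ empties the queue before it answers. A chain taken from the queue is discarded if a pair of its consecutive elements belongs to a chain that was checked or completed before; otherwise it is checked, i.e. the values $C\tilde F$ of its elements are computed by running $\mathcal A$ on the table; if all of them equal the values of $CF$, the chain is completed: with $u=4n$ if $s>5n$ or $s+\lambda-1<3n$, and $u=7n$ otherwise, the sequence determined by $x_s,x_{s+1}$ and the values $C\tilde F$ is computed forward to $x_{u-1},x_u$ and backward to $x_{u+1},x_{u+2}$, passing from one end of the Feistel network to the other through $P^{\pm1}$, and $\mathcal S$ sets $CF_u(x_u)=x_{u-1}\oplus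 x_{u+1}$ and $CF_{u+1}(x_{u+1})=x_u\oplus x_{u+2}$; it aborts if one of these was already defined, or differs from its subverted value, or is queried by $\mathcal A$ when evaluated at another element of the completed chain. *The lifted simulator $\mathcal S_F$.* In the first phase it answers new queries with independent uniform strings. When it gets $R$ and $\mathcal A$, it starts $\mathcal S(R,\mathcal A)$ and asks it the queries of the first phase, the recorded answers serving as the random values of $\mathcal S$; it aborts if the queried terms contain an unsubverted chain of length $\lambda$. From then on it answers as $\mathcal S$. **Theorem.** If the construction is abbreviated-crooked-indifferentiable from $P$ by means of $\mathcal S$ with parameters $(q_{\mathcal D},\,q_{\mathcal A}+q_{\mathcal D},\,\epsilon,\,\epsilon')$, then it is crooked-indifferentiable from $P$ in the full model by means of $\mathcal S_F$ with parameters $$\bigl(q_{\mathcal D},\;q_{\mathcal A},\;\epsilon,\;\epsilon'+8n\cdot q_{\mathcal D}^{\,n/10}\cdot 2^{\,2n-n^2/10}\bigr).$$ -/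

import Mathlib

/-! ### Oracle programs -/

/-- A program with oracle access: it either returns a value, or asks a query `q` and continues
with the answer.  (A decision tree: between two queries the computation is unrestricted.) -/
inductive OracleProg (Q : Type) (A : Q → Type) (α : Type) : Type where
  | done (a : α) : OracleProg Q A α
  | query (q : Q) (k : A q → OracleProg Q A α) : OracleProg Q A α

namespace OracleProg

variable {Q : Type} {A : Q → Type} {α β : Type}

protected def bind : OracleProg Q A α → (α → OracleProg Q A β) → OracleProg Q A β
  | done a, f => f a
  | query q k, f => query q (fun y => (k y).bind f)

instance : Monad (OracleProg Q A) where
  pure := done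
  bind := OracleProg.bind

/-- Run the program with the oracle `O`. -/
def eval (O : (q : Q) → A q) : OracleProg Q A α → α
  | done a => a
  | query q k => (k (O q)).eval O

/-- Whatever the answers are, the program returns, after at most `m` queries, a value `a` such
that `post a r` holds, where `r` is the number of queries that are then left. -/
def Within (post : α → ℕ → Prop) : OracleProg Q A α → ℕ → Prop
  | done a, m => post a m
  | query _ _, 0 => False
  | query _ k, m + 1 => ∀ y, (k y).Within post m

/-- Whatever the answers are, the program makes at most `m` queries. -/
def AtMost (p : OracleProg Q A α) (m : ℕ) : Prop :=
  p.Within (fun _ _ => True) m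

end OracleProg

/-! ### The construction -/

/-- Strings of `n` bits; addition is bitwise exclusive or. -/
abbrev Word (n : ℕ) : Type := Fin n → ZMod 2

/-- The points `(i, x)` of the family of the `8 * n` round functions.  The round with index `i`
in `{1, …, 8 n}` is represented by `i - 1 : Fin (8 * n)`. -/
abbrev Term (n : ℕ) : Type := Fin (8 * n) × Word n

/-- Values of the source function, a family of `8 * n` functions on `n`-bit strings. -/
abbrev Source (n : ℕ) : Type := Term n → Word n

/-- The public randomness: an invertible matrix `a i` and a vector `b i` for each round. -/
abbrev PubRand (n : ℕ) : Type :=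
  Fin (8 * n) → Matrix.GeneralLinearGroup (Fin n) (ZMod 2) × Word n

namespace PubRand

variable {n : ℕ}

/-- `x ↦ a i * x + b i`. -/
def aff (R : PubRand n) (i : Fin (8 * n)) (x : Word n) : Word n :=
  ((R i).1 : Matrix (Fin n) (Fin n) (ZMod 2)).mulVec x + (R i).2

/-- The inverse of `aff`. -/
def affInv (R : PubRand n) (i : Fin (8 * n)) (z : Word n) : Word n :=
  (((R i).1⁻¹ : Matrix.GeneralLinearGroup (Fin n) (ZMod 2)) :
    Matrix (Fin n) (Fin n) (ZMod 2)).mulVec (z - (R i).2)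

end PubRand

/-- A subversion algorithm: on input a term it computes the subverted value at that term, with
oracle access to the source function. -/
abbrev Subversion (n : ℕ) : Type :=
  Term n → OracleProg (Term n) (fun _ => Word n) (Word n)

/-- The subverted source function. -/
def Subversion.apply {n : ℕ} (A : Subversion n) (F : Source n) : Source n :=
  fun t => (A t).eval F

/-- The algorithm makes at most `q` queries on each input and, whatever the source function is,
each of its round functions is changed on at most an `ε`-fraction of the inputs. -/
def Subversion.Admissible {n : ℕ} (A : Subversion n) (q : ℕ) (ε : ℝ) : Prop :=
  (∀ t, (A t).AtMost q) ∧
  ∀ (F : Source n) (i : Fin (8 * n)),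
    ((Finset.univ.filter fun x : Word n => A.apply F (i, x) ≠ F (i, x)).card : ℝ) / 2 ^ n ≤ ε

/-- The Feistel construction with the (subverted) source function `G`:
`(x₀, x₁) ↦ (x_{8n}, x_{8n+1})`, where `x_{i+1} = x_{i-1} + G_i (a_i x_i + b_i)`. -/
def feistel {n : ℕ} (G : Source n) (R : PubRand n) (x : Word n × Word n) : Word n × Word n :=
  Fin.foldl (8 * n) (fun p i => (p.2, p.1 + G (i, R.aff i p.2))) x

/-- The inverse of the Feistel construction. -/
def feistelInv {n : ℕ} (G : Source n) (R : PubRand n) (x : Word n × Word n) :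
    Word n × Word n :=
  Fin.foldr (8 * n) (fun i p => (p.2 + G (i, R.aff i p.1), p.1)) x

/-! ### Distinguishers -/

/-- The queries of a distinguisher once the public randomness is known: to the source function
(real world: `F`; ideal world: simulator), and to the permutation in both directions
(real world: the construction; ideal world: the random permutation). -/
inductive DistQuery (n : ℕ) : Type where
  | source (t : Term n) : DistQuery n
  | perm (x : Word n × Word n) : DistQuery n
  | permInv (x : Word n × Word n) : DistQuery n

def DistQuery.Ans {n : ℕ} : DistQuery n → Type
  | .source _ => Word n
  | .perm _ => Word n × Word n
  | .permInv _ => Word n × Word n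

/-- The second phase of a distinguisher, which ends with a decision bit. -/
abbrev SecondPhase (n : ℕ) : Type := OracleProg (DistQuery n) DistQuery.Ans Bool

/-- A (randomized) distinguisher of the abbreviated model with `m` random coins: it
receives its coins and the public randomness. -/
abbrev AbbrDistinguisher (n m : ℕ) : Type := (Fin m → Bool) → PubRand n → SecondPhase n

/-- A (randomized) distinguisher of the full model with `m` random coins: it receives its coins,
queries the source function, publishes a subversion algorithm, and then receives the public
randomness and continues with the second phase (which may use all that was seen before). -/
abbrev FullDistinguisher (n m : ℕ) : Type :=
  (Fin m → Bool) →
    OracleProg (Term n) (fun _ => Word n) (Subversion n × (PubRand n → SecondPhase n))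

/-- At most `q` queries are made. -/
def AbbrDistinguisher.AtMost {n m : ℕ} (D : AbbrDistinguisher n m) (q : ℕ) : Prop :=
  ∀ u R, (D u R).AtMost q

/-- At most `q` queries are made in both phases together, and the published subversion
algorithm is admissible. -/
def FullDistinguisher.Admissible {n m : ℕ} (D : FullDistinguisher n m) (q qA : ℕ) (ε : ℝ) :
    Prop :=
  ∀ u, (D u).Within (fun out r => out.1.Admissible qA ε ∧ ∀ R, (out.2 R).AtMost r) q

/-! ### Simulators -/

/-- The operations of a simulator: `tick c` accounts for `c` elementary steps (a step is a table
access, an operation on `n`-bit strings, or a step of the simulated subversion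
algorithm up to its next query), `coin` draws a uniform `n`-bit string, `perm` and `permInv` query
the random permutation, `abort` aborts the game. -/
inductive SimOp (n : ℕ) : Type where
  | tick (c : ℕ) : SimOp n
  | coin : SimOp n
  | perm (x : Word n × Word n) : SimOp n
  | permInv (x : Word n × Word n) : SimOp n
  | abort : SimOp n

def SimOp.Ans {n : ℕ} : SimOp n → Type
  | .tick _ => Unit
  | .coin => Word n
  | .perm _ => Word n × Word n
  | .permInv _ => Word n × Word n
  | .abort => Empty

abbrev SimProg (n : ℕ) (α : Type) : Type := OracleProg (SimOp n) SimOp.Ans α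

/-- A simulator of the abbreviated model: it starts with the public randomness and the subversion
algorithm, keeps a state, and answers queries to the source function. -/
structure AbbrSimulator (n : ℕ) where
  State : Type
  init : PubRand n → Subversion n → State
  answer : Term n → State → SimProg n (Word n × State)

/-- A simulator of the full model: it answers source queries in the first phase, then receives
the public randomness and the subversion algorithm, and answers source queries in the second
phase. -/
structure FullSimulator (n : ℕ) where
  State₁ : Type
  State₂ : Type
  init : State₁
  answer₁ : Term n → State₁ → SimProg n (Word n × State₁)
  setup : PubRand n → Subversion n → State₁ → SimProg n State₂
  answer₂ : Term n → State₂ → SimProg n (Word n × State₂)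

noncomputable section

/-- Run a simulator program with the permutation `P`.  The result is the returned value (`none`
if the game was aborted) and the number of steps. -/
def SimProg.run {n : ℕ} {α : Type} (P : Equiv.Perm (Word n × Word n)) :
    SimProg n α → PMF (Option α × ℕ)
  | .done a => PMF.pure (some a, 0)
  | .query (.tick c) k => (SimProg.run P (k ())).map fun r => (r.1, r.2 + c)
  | .query .coin k => (PMF.uniformOfFintype (Word n)).bind fun v =>
      (SimProg.run P (k v)).map fun r => (r.1, r.2 + 1)
  | .query (.perm x) k => (SimProg.run P (k (P x))).map fun r => (r.1, r.2 + 1)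
  | .query (.permInv x) k => (SimProg.run P (k (P.symm x))).map fun r => (r.1, r.2 + 1)
  | .query .abort _ => PMF.pure (none, 0)

/-- Continue a run after its first part, unless the game was aborted; steps are added. -/
def andThen {α β : Type} (r : PMF (Option α × ℕ)) (f : α → PMF (Option β × ℕ)) :
    PMF (Option β × ℕ) :=
  r.bind fun o =>
    match o with
    | (none, c) => PMF.pure (none, c)
    | (some a, c) => (f a).map fun r' => (r'.1, c + r'.2)

/-- The second phase in the ideal world: source queries go to the simulator (given by
its procedure `ans` and its current state), the others to the permutation `P`.  Only
the steps of the simulator are counted. -/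
def idealSecond {n : ℕ} {σ : Type} (P : Equiv.Perm (Word n × Word n))
    (ans : Term n → σ → SimProg n (Word n × σ)) : SecondPhase n → σ → PMF (Option Bool × ℕ)
  | .done b, _ => PMF.pure (some b, 0)
  | .query (.source t) k, st =>
      andThen ((ans t st).run P) fun r => idealSecond P ans (k r.1) r.2
  | .query (.perm x) k, st => idealSecond P ans (k (P x)) st
  | .query (.permInv x) k, st => idealSecond P ans (k (P.symm x)) st

/-- The first phase in the ideal world: source queries go to the simulator. -/
def idealFirst {n : ℕ} {σ α : Type} (P : Equiv.Perm (Word n × Word n))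
    (ans : Term n → σ → SimProg n (Word n × σ)) :
    OracleProg (Term n) (fun _ => Word n) α → σ → PMF (Option (α × σ) × ℕ)
  | .done a, st => PMF.pure (some (a, st), 0)
  | .query t k, st => andThen ((ans t st).run P) fun r => idealFirst P ans (k r.1) r.2

/-- The oracles of the second phase in the real world. -/
def realOracle {n : ℕ} (F : Source n) (A : Subversion n) (R : PubRand n) :
    (q : DistQuery n) → q.Ans
  | .source t => F t
  | .perm x => feistel (A.apply F) R x
  | .permInv x => feistelInv (A.apply F) R x

instance (n : ℕ) : Fintype (PubRand n) := Fintype.ofFinite _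

/-- The real world of the abbreviated model: the decision bit. -/
def abbrReal {n m : ℕ} (D : AbbrDistinguisher n m) (A : Subversion n) : PMF Bool :=
  (PMF.uniformOfFintype (Fin m → Bool)).bind fun u =>
  (PMF.uniformOfFintype (Source n)).bind fun F =>
  (PMF.uniformOfFintype (PubRand n)).bind fun R =>
  PMF.pure ((D u R).eval (realOracle F A R))

/-- The ideal world of the abbreviated model: the decision bit (`none` if the
game was aborted), and the number of steps of the simulator. -/
def abbrIdeal {n m : ℕ} (S : AbbrSimulator n) (D : AbbrDistinguisher n m) (A : Subversion n) :
    PMF (Option Bool × ℕ) :=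
  (PMF.uniformOfFintype (Fin m → Bool)).bind fun u =>
  (PMF.uniformOfFintype (Equiv.Perm (Word n × Word n))).bind fun P =>
  (PMF.uniformOfFintype (PubRand n)).bind fun R =>
  idealSecond P S.answer (D u R) (S.init R A)

/-- The real world of the full model: the decision bit. -/
def fullReal {n m : ℕ} (D : FullDistinguisher n m) : PMF Bool :=
  (PMF.uniformOfFintype (Fin m → Bool)).bind fun u =>
  (PMF.uniformOfFintype (Source n)).bind fun F =>
  (PMF.uniformOfFintype (PubRand n)).bind fun R =>
  let out := (D u).eval F
  PMF.pure ((out.2 R).eval (realOracle F out.1 R))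

/-- The ideal world of the full model: the decision bit (`none` if the game was
aborted), and the number of steps of the simulator. -/
def fullIdeal {n m : ℕ} (S : FullSimulator n) (D : FullDistinguisher n m) :
    PMF (Option Bool × ℕ) :=
  (PMF.uniformOfFintype (Fin m → Bool)).bind fun u =>
  (PMF.uniformOfFintype (Equiv.Perm (Word n × Word n))).bind fun P =>
  andThen (idealFirst P S.answer₁ (D u) S.init) fun o =>
  (PMF.uniformOfFintype (PubRand n)).bind fun R =>
  andThen ((S.setup R o.1.1 o.2).run P) fun st =>
  idealSecond P S.answer₂ (o.1.2 R) st

/-- The distance between the probabilities that the distinguisher outputs `1` in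
the two worlds. -/
def advantage (real : PMF Bool) (ideal : PMF (Option Bool × ℕ)) : ℝ :=
  |(real true).toReal - ((ideal.map Prod.fst) (some true)).toReal|

/-- The probability that the simulator makes more than `c` steps. -/
def stepsExceed (ideal : PMF (Option Bool × ℕ)) (c : ℕ) : ℝ :=
  (ideal.toOuterMeasure {r | c < r.2}).toReal

/-- `ν` is negligible. -/
def Negligible (ν : ℕ → ℝ) : Prop :=
  Asymptotics.SuperpolynomialDecay Filter.atTop (fun n : ℕ => (n : ℝ)) ν

/-- The construction is abbreviated-crooked-indifferentiable from a random permutation by means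
of the simulator `S`, with advantage at most `ε'`, for distinguishers that make at most `qD`
queries and subversion algorithms that make at most `qA` queries and subvert at most an
`ε`-fraction of each round function; and `S` is efficient: with
overwhelming probability it makes only polynomially many steps. -/
def AbbrCrookedIndifferentiable (S : (n : ℕ) → AbbrSimulator n) (qD qA : ℕ → ℕ)
    (ε ε' : ℕ → ℝ) : Prop :=
  (∃ (p : Polynomial ℕ) (ν : ℕ → ℝ), Negligible ν ∧
    ∀ (n m : ℕ) (D : AbbrDistinguisher n m) (A : Subversion n),
      D.AtMost (qD n) → A.Admissible (qA n) (ε n) →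
      stepsExceed (abbrIdeal (S n) D A) (p.eval (n + qD n + qA n)) ≤ ν n) ∧
  ∀ (n m : ℕ) (D : AbbrDistinguisher n m) (A : Subversion n),
    D.AtMost (qD n) → A.Admissible (qA n) (ε n) →
    advantage (abbrReal D A) (abbrIdeal (S n) D A) ≤ ε' n

/-- The same in the full model. -/
def CrookedIndifferentiable (S : (n : ℕ) → FullSimulator n) (qD qA : ℕ → ℕ)
    (ε ε' : ℕ → ℝ) : Prop :=
  (∃ (p : Polynomial ℕ) (ν : ℕ → ℝ), Negligible ν ∧
    ∀ (n m : ℕ) (D : FullDistinguisher n m), D.Admissible (qD n) (qA n) (ε n) →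
      stepsExceed (fullIdeal (S n) D) (p.eval (n + qD n + qA n)) ≤ ν n) ∧
  ∀ (n m : ℕ) (D : FullDistinguisher n m), D.Admissible (qD n) (qA n) (ε n) →
    advantage (fullReal D) (fullIdeal (S n) D) ≤ ε' n

end

/-! ### The chain-completing simulator -/

/-- The length `n / 10` (rounded up) of the chains that trigger completion; chains have length
at least two. -/
def trigLen (n : ℕ) : ℕ := max 2 ((n + 9) / 10)

/-- The table of the source values that are already defined, the newest first. -/
abbrev Table (n : ℕ) : Type := List (Term n × Word n)

/-- An unsubverted chain `(s, x_s, …, x_{s+r})`; positions are in `{1, …, 8 n}`. -/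
abbrev Chain (n : ℕ) : Type := ℕ × List (Word n)

/-- The index of the round function at position `i`, if there is one. -/
def slot (n i : ℕ) : Option (Fin (8 * n)) :=
  if h : 1 ≤ i ∧ i ≤ 8 * n then some ⟨i - 1, by omega⟩ else none

/-- The value at `x` of the round function `x ↦ F_i (a_i x + b_i)` at position `i`, if it is
defined in the table. -/
def roundVal {n : ℕ} (R : PubRand n) (T : Table n) (i : ℕ) (x : Word n) : Option (Word n) :=
  (slot n i).bind fun j => T.lookup (j, R.aff j x)

/-- The `x` with `(position i, x)` in the table, for the given position `i`. -/
def column {n : ℕ} (R : PubRand n) (T : Table n) (i : ℕ) : List (Word n) :=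
  T.filterMap fun e => if e.1.1.val + 1 = i then some (R.affInv e.1.1 e.1.2) else none

/-- For `x` at position `i - 1` and `x'` at position `i`: the `m` elements `x_i = x', x_{i+1}, …`
of the unsubverted chain that continues to the right, if they are all defined. -/
def walkRight {n : ℕ} (R : PubRand n) (T : Table n) :
    ℕ → ℕ → Word n → Word n → Option (List (Word n))
  | 0, _, _, _ => some []
  | m + 1, i, x, x' =>
    (roundVal R T i x').bind fun y => (walkRight R T m (i + 1) x' (x + y)).map (x' :: ·)

/-- For `x` at position `i + 1` and `x'` at position `i`: the `m` elements `…, x_{i-1}, x_i = x'`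
of the unsubverted chain that continues to the left, if they are all defined. -/
def walkLeft {n : ℕ} (R : PubRand n) (T : Table n) :
    ℕ → ℕ → Word n → Word n → Option (List (Word n))
  | 0, _, _, _ => some []
  | m + 1, i, x, x' =>
    (roundVal R T i x').bind fun y => (walkLeft R T m (i - 1) x' (x + y)).map (· ++ [x'])

/-- The unsubverted chains of length `trigLen n` in the table that end or begin with `x` at
position `i`, for a term that is in the table. -/
def newChains {n : ℕ} (R : PubRand n) (T : Table n) (i : ℕ) (x : Word n) : List (Chain n) :=
  ((column R T (i - 1)).filterMap fun x' =>
    (walkLeft R T (trigLen n - 1) (i - 1) x x').map fun l => (i + 1 - trigLen n, l ++ [x])) ++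
  ((column R T (i + 1)).filterMap fun x' =>
    (walkRight R T (trigLen n - 1) (i + 1) x x').map fun l => (i, x :: l))

/-- There is an unsubverted chain of length `trigLen n` in the table. -/
def hasLongChain {n : ℕ} (R : PubRand n) (T : Table n) : Bool :=
  T.any fun e => (column R T (e.1.1.val + 2)).any fun x' =>
    (walkRight R T (trigLen n - 1) (e.1.1.val + 2) (R.affInv e.1.1 e.1.2) x').isSome

/-- The state of the simulator.  An entry `(i, x, x')` of `completed` or `checked` is the pair of
consecutive elements `x_i = x`, `x_{i+1} = x'` of a chain. -/
structure SimState (n : ℕ) where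
  table : Table n
  queue : List (Chain n)
  completed : List (ℕ × Word n × Word n)
  checked : List (ℕ × Word n × Word n)

/-- The state at the beginning. -/
def SimState.start (n : ℕ) : SimState n := ⟨[], [], [], []⟩

namespace Sim

abbrev M (n : ℕ) : Type → Type := StateT (SimState n) (OracleProg (SimOp n) SimOp.Ans)

variable {n : ℕ}

def tick (c : ℕ) : M n Unit :=
  StateT.lift (OracleProg.query (SimOp.tick c) OracleProg.done)

def coin : M n (Word n) :=
  StateT.lift (OracleProg.query SimOp.coin OracleProg.done)

def perm (x : Word n × Word n) : M n (Word n × Word n) :=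
  StateT.lift (OracleProg.query (SimOp.perm x) OracleProg.done)

def permInv (x : Word n × Word n) : M n (Word n × Word n) :=
  StateT.lift (OracleProg.query (SimOp.permInv x) OracleProg.done)

def abort {α : Type} : M n α :=
  StateT.lift (OracleProg.query SimOp.abort (fun y => nomatch y))

/-- Define the value at `t` as `y`, and append the chains that this term ends or begins to
the queue. -/
def record (R : PubRand n) (t : Term n) (y : Word n) : M n Unit := do
  let st ← get
  let T := (t, y) :: st.table
  tick (2 * T.length * trigLen n + 1)
  set { st with
    table := T
    queue := st.queue ++ newChains R T (t.1.val + 1) (R.affInv t.1 t.2) }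

/-- The value at `t`, which is drawn uniformly if it is not yet defined. -/
def inner (R : PubRand n) (t : Term n) : M n (Word n) := do
  tick 1
  let st ← get
  match st.table.lookup t with
  | some y => pure y
  | none =>
    let y ← coin
    record R t y
    pure y

/-- Simulate a run of the subversion algorithm; the result is its value and the list of
its queries. -/
def runSub (R : PubRand n) :
    OracleProg (Term n) (fun _ => Word n) (Word n) → M n (Word n × List (Term n))
  | .done y => pure (y, [])
  | .query t k => do
    let y ← inner R t
    let r ← runSub R (k y)
    pure (r.1, t :: r.2)

/-- Evaluate the subverted round function at position `i` on `x`. -/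
def subVal (R : PubRand n) (A : Subversion n) (i : ℕ) (x : Word n) :
    M n (Word n × List (Term n)) := do
  tick 1
  match slot n i with
  | some j => runSub R (A (j, R.aff j x))
  | none => abort

/-- Evaluate the subverted round functions on the elements of a chain, which begins at position
`i`, mark its pairs as checked, and decide whether all its elements are honest. -/
def honestyCheck (R : PubRand n) (A : Subversion n) : ℕ → List (Word n) → M n Bool
  | _, [] => pure true
  | i, x :: xs => do
    match xs with
    | [] => pure ()
    | x' :: _ => modify fun st => { st with checked := (i, x, x') :: st.checked }
    let r ← subVal R A i x
    let st ← get
    let b ← honestyCheck R A (i + 1) xs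
    pure (decide (roundVal R st.table i x = some r.1) && b)

/-- From `x_s = x`, `x_{s+1} = x'` compute `x_{u-1}`, `x_u` along the subverted chain, with the
permutation used to step from the right end to the left end.  The last component lists, for the
positions that were evaluated, the queries of the subversion algorithm.  The first argument
is a bound for the number of steps; `8 * n + 1` suffices. -/
def evalForward (R : PubRand n) (A : Subversion n) (u : ℕ) :
    ℕ → ℕ → Word n → Word n → M n (Word n × Word n × List (ℕ × List (Term n)))
  | fuel, s, x, x' =>
    if s + 1 = u then pure (x, x', []) else
    match fuel with
    | 0 => abort
    | fuel + 1 =>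
      if s = 8 * n then do
        let z ← permInv (x, x')
        evalForward R A u fuel 0 z.1 z.2
      else do
        let r ← subVal R A (s + 1) x'
        modify fun st => { st with completed := (s + 1, x', x + r.1) :: st.completed }
        let o ← evalForward R A u fuel (s + 1) x' (x + r.1)
        pure (o.1, o.2.1, (s + 1, r.2) :: o.2.2)

/-- From `x_s = x`, `x_{s+1} = x'` compute `x_{u+1}`, `x_{u+2}` along the subverted chain in the
other direction. -/
def evalBackward (R : PubRand n) (A : Subversion n) (u : ℕ) :
    ℕ → ℕ → Word n → Word n → M n (Word n × Word n × List (ℕ × List (Term n)))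
  | fuel, s, x, x' =>
    if s = u + 1 then pure (x, x', []) else
    match fuel with
    | 0 => abort
    | fuel + 1 =>
      if s = 0 then do
        let z ← perm (x, x')
        evalBackward R A u fuel (8 * n) z.1 z.2
      else do
        let r ← subVal R A s x
        modify fun st => { st with completed := (s - 1, x' + r.1, x) :: st.completed }
        let o ← evalBackward R A u fuel (s - 1) (x' + r.1) x
        pure (o.1, o.2.1, (s, r.2) :: o.2.2)

/-- Define the values at positions `u`, `u + 1` such that the chain becomes consistent with
the permutation; abort if one of them is already defined, or is dishonest, or is queried by the
subversion algorithm at another element of the chain (`Qs` lists those queries). -/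
def adapt (R : PubRand n) (A : Subversion n) (u : ℕ) (w x y z : Word n)
    (Qs : List (ℕ × List (Term n))) : M n Unit := do
  match slot n u, slot n (u + 1) with
  | some i, some j =>
    let s : Term n := (i, R.aff i x)
    let t : Term n := (j, R.aff j y)
    let st ← get
    tick 4
    if (st.table.lookup s).isSome ∨ (st.table.lookup t).isSome then abort else
    set { st with table := (t, x + z) :: (s, w + y) :: st.table }
    let r ← subVal R A u x
    let r' ← subVal R A (u + 1) y
    if r.1 = w + y ∧ r'.1 = x + z then
      modify fun st => { st with completed := (u, x, y) :: st.completed }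
    else abort
    let Qs' := (u, r.2) :: (u + 1, r'.2) :: Qs
    tick ((Qs'.map fun e => e.2.length).sum)
    if (∃ e ∈ Qs', e.1 ≠ u ∧ s ∈ e.2) ∨ (∃ e ∈ Qs', e.1 ≠ u + 1 ∧ t ∈ e.2) then abort
    else pure ()
  | _, _ => abort

/-- Complete the subverted chain through `x_s = x`, `x_{s+1} = x'`, adapting at `u`, `u + 1`. -/
def complete (R : PubRand n) (A : Subversion n) (s : ℕ) (x x' : Word n) (u : ℕ) :
    M n Unit := do
  modify fun st => { st with completed := (s, x, x') :: st.completed }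
  let f ← evalForward R A u (8 * n + 1) s x x'
  let b ← evalBackward R A u (8 * n + 1) s x x'
  adapt R A u f.1 f.2.1 b.1 b.2.1 (f.2.2 ++ b.2.2)

/-- The pairs of consecutive elements of a list whose first element is at position `i`. -/
def pairs : ℕ → List (Word n) → List (ℕ × Word n × Word n)
  | i, x :: x' :: xs => (i, x, x') :: pairs (i + 1) (x' :: xs)
  | _, _ => []

/-- Treat a chain from the queue: it is discarded if one of its pairs belongs to a chain that was
completed or checked before; otherwise it is checked, and completed if all of it is honest. -/
def process (R : PubRand n) (A : Subversion n) (c : Chain n) : M n Unit := do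
  let st ← get
  tick (2 * trigLen n)
  if ∃ p ∈ pairs c.1 c.2, p ∈ st.completed ∨ p ∈ st.checked then pure () else
  let b ← honestyCheck R A c.1 c.2
  match b, c.2 with
  | true, x :: x' :: _ =>
    complete R A c.1 x x'
      (if 5 * n < c.1 ∨ c.1 + trigLen n - 1 < 3 * n then 4 * n else 7 * n)
  | _, _ => pure ()

/-- Treat the chains of the queue, first in, first out, until it is empty.  The first argument
bounds the number of rounds. -/
def emptyQueue (R : PubRand n) (A : Subversion n) : ℕ → M n Unit
  | 0 => abort
  | fuel + 1 => do
    let st ← get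
    match st.queue with
    | [] => pure ()
    | c :: rest =>
      set { st with queue := rest }
      process R A c
      emptyQueue R A fuel

/-- Answer a query to the source function.  A chain is determined by its position and its first
two elements and enters the queue at most once, so the bound is never reached. -/
def answer (R : PubRand n) (A : Subversion n) (t : Term n) : M n (Word n) := do
  let y ← inner R t
  emptyQueue R A (8 * n * 4 ^ n + 1)
  pure y

/-- Ask the recorded queries again, oldest first, with the recorded answers as the random values
of the simulator. -/
def replay (R : PubRand n) : Table n → M n Unit
  | [] => pure ()
  | e :: T => do
    replay R T
    record R e.1 e.2

end Sim

/-- The simulator of the abbreviated model. -/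
def chainSimulator (n : ℕ) : AbbrSimulator n where
  State := PubRand n × Subversion n × SimState n
  init R A := (R, A, SimState.start n)
  answer t st := do
    let r ← (Sim.answer st.1 st.2.1 t).run st.2.2
    pure (r.1, st.1, st.2.1, r.2)

/-- The lifted simulator.  In the first phase it answers with fresh uniform values.  When it gets
the public randomness and the subversion algorithm, it starts the simulator of the
abbreviated model and asks it the queries of the first phase; it aborts if their
terms contain an unsubverted chain of length `trigLen n`.  Then it answers as that simulator. -/
def liftedSimulator (n : ℕ) : FullSimulator n where
  State₁ := Table n
  State₂ := PubRand n × Subversion n × SimState n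
  init := []
  answer₁ t T :=
    .query (.tick 1) fun _ =>
      match T.lookup t with
      | some y => .done (y, T)
      | none => .query .coin fun y => .done (y, (t, y) :: T)
  setup R A T := do
    let r ← (Sim.replay R T).run (SimState.start n)
    .query (.tick (T.length ^ 2 * trigLen n)) fun _ =>
      if hasLongChain R T then .query .abort (fun y => nomatch y)
      else .done (R, A, r.2)
  answer₂ := (chainSimulator n).answer

/-!
The distinguisher of the full model is turned into an adversary of the abbreviated model as follows.
Fix its coins, and let `p` be its first phase, a program that queries the source function and
publishes a subversion algorithm.  In the abbreviated model the subversion algorithm must be known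
in advance; `FirstPhase.subversion` therefore repeats `p` on every input, to find out which
algorithm `p` publishes, and runs that one.  For every source function it computes the same values
as the published algorithm, so it is admissible, at the cost of the additional queries of `p`.
`FirstPhase.distinguisher` makes the queries of `p` when it already knows the public randomness
and continues with the second phase.  The real worlds of the two games are then equal
(`FirstPhase.abbrReal_distinguisher`).

The ideal worlds are compared by a coupling.  As long as the first-phase terms contain no
unsubverted chain of length `trigLen n`, the simulator of the abbreviated model enqueues
nothing and answers with fresh uniform values, like the lifted simulator (`coupled_idealFirst`); if
they do contain one at the end, the lifted simulator aborts.  Afterwards the two simulators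
run in the same state, but one simulates the published algorithm and the other one repeats `p`
before it.  The repeated queries hit the table, so they cost only steps and have no effect on the
state.  They could matter only in the abort condition of `Sim.adapt`, which looks for
queries of the adapted terms; but these terms are missing from the table, hence are not terms of the
first phase (`Sim.mrel_adapt`).  So the worlds differ only if there is a long chain
(`coupled_flaggedGame`), and the lifted simulator takes at most a polynomial number of steps more.

The terms of the first phase do not depend on the public randomness.  Given `trigLen n` entries of
the table in consecutive rounds, the `trigLen n - 2` equations of a chain determine as many of
the vectors `b i` from the rest of the randomness (`EntriesChain.injOn`), so they hold
with probability at most `2 ^ (-n * (trigLen n - 2))`.  A union bound over the sequences of entries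
gives `prob_hasLongChain_le`.
-/

/-! ### Couplings -/

/-- The two distributions are the marginals of a joint distribution whose outcomes all
satisfy `r`. -/
def Coupled {α β : Type} (r : α → β → Prop) (μ : PMF α) (ν : PMF β) : Prop :=
  ∃ κ : PMF (α × β), κ.map Prod.fst = μ ∧ κ.map Prod.snd = ν ∧ ∀ x ∈ κ.support, r x.1 x.2

namespace Coupled

variable {α β γ δ : Type}

theorem mono {r s : α → β → Prop} {μ : PMF α} {ν : PMF β} (h : Coupled r μ ν)
    (hrs : ∀ a ∈ μ.support, ∀ b ∈ ν.support, r a b → s a b) : Coupled s μ ν := by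
  obtain ⟨κ, h1, h2, h3⟩ := h
  refine ⟨κ, h1, h2, fun x hx => hrs _ ?_ _ ?_ (h3 x hx)⟩
  · rw [← h1, PMF.support_map]; exact ⟨x, hx, rfl⟩
  · rw [← h2, PMF.support_map]; exact ⟨x, hx, rfl⟩

theorem pure {r : α → β → Prop} {a : α} {b : β} (h : r a b) :
    Coupled r (PMF.pure a) (PMF.pure b) :=
  ⟨PMF.pure (a, b), PMF.pure_map _ _, PMF.pure_map _ _, by
    intro x hx
    rw [PMF.support_pure, Set.mem_singleton_iff] at hx
    subst hx; exact h⟩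

theorem indep (μ : PMF α) (ν : PMF β) : Coupled (fun _ _ => True) μ ν :=
  ⟨μ.bind fun a => ν.map fun b => (a, b), by
      simp only [PMF.map_bind, PMF.map_comp]
      exact (congrArg _ (funext fun a => PMF.map_const ν a)).trans μ.bind_pure, by
      simp only [PMF.map_bind, PMF.map_comp]
      exact (congrArg _ (funext fun a => PMF.map_id ν)).trans (PMF.bind_const μ ν),
    fun _ _ => trivial⟩

theorem refl (μ : PMF α) : Coupled Eq μ μ :=
  ⟨μ.map fun a => (a, a), by rw [PMF.map_comp]; exact PMF.map_id μ,
    by rw [PMF.map_comp]; exact PMF.map_id μ, by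
    intro x hx
    rw [PMF.support_map] at hx
    obtain ⟨a, -, rfl⟩ := hx
    rfl⟩

theorem bind {r : α → β → Prop} {s : γ → δ → Prop} {μ : PMF α} {ν : PMF β}
    {f : α → PMF γ} {g : β → PMF δ} (h : Coupled r μ ν)
    (hfg : ∀ a b, r a b → Coupled s (f a) (g b)) : Coupled s (μ.bind f) (ν.bind g) := by
  classical
  obtain ⟨κ, rfl, rfl, h3⟩ := h
  choose η h4 h5 h6 using hfg
  choose η' h4' h5' _ using fun a b => indep (f a) (g b)
  have e1 : ∀ x : α × β, PMF.map Prod.fst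
      (if h : r x.1 x.2 then η x.1 x.2 h else η' x.1 x.2) = f x.1 := by
    intro x; split_ifs with h
    · exact h4 _ _ h
    · exact h4' _ _
  have e2 : ∀ x : α × β, PMF.map Prod.snd
      (if h : r x.1 x.2 then η x.1 x.2 h else η' x.1 x.2) = g x.2 := by
    intro x; split_ifs with h
    · exact h5 _ _ h
    · exact h5' _ _
  refine ⟨κ.bind fun x => if h : r x.1 x.2 then η x.1 x.2 h else η' x.1 x.2, ?_, ?_, ?_⟩
  · rw [PMF.map_bind, PMF.bind_map]; exact congrArg _ (funext e1)
  · rw [PMF.map_bind, PMF.bind_map]; exact congrArg _ (funext e2)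
  · intro y hy
    rw [PMF.mem_support_bind_iff] at hy
    obtain ⟨x, hx, hy⟩ := hy
    rw [dif_pos (h3 x hx)] at hy
    exact h6 _ _ _ y hy

theorem bind_same {s : γ → δ → Prop} (μ : PMF α) {f : α → PMF γ} {g : α → PMF δ}
    (hfg : ∀ a, Coupled s (f a) (g a)) : Coupled s (μ.bind f) (μ.bind g) :=
  (refl μ).bind fun a _ h => h ▸ hfg a

theorem map {r : α → β → Prop} {s : γ → δ → Prop} {μ : PMF α} {ν : PMF β}
    {f : α → γ} {g : β → δ} (h : Coupled r μ ν) (hfg : ∀ a b, r a b → s (f a) (g b)) :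
    Coupled s (μ.map f) (ν.map g) :=
  h.bind fun a b hab => pure (hfg a b hab)

theorem toOuterMeasure_le {r : α → β → Prop} {μ : PMF α} {ν : PMF β} (h : Coupled r μ ν)
    {A : Set α} {B : Set β} (hAB : ∀ a b, r a b → a ∈ A → b ∈ B) :
    μ.toOuterMeasure A ≤ ν.toOuterMeasure B := by
  obtain ⟨κ, rfl, rfl, h3⟩ := h
  rw [PMF.toOuterMeasure_map_apply, PMF.toOuterMeasure_map_apply]
  exact PMF.toOuterMeasure_mono _ fun x hx => hAB _ _ (h3 x hx.2) hx.1

end Coupled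

/-! ### Comparing simulator programs -/

theorem OracleProg.bind_done {Q : Type} {A : Q → Type} {α : Type} (p : OracleProg Q A α) :
    p.bind .done = p := by
  induction p with
  | done a => rfl
  | query q k ih => exact congrArg _ (funext ih)

/-- The programs make the same moves with related results, except that the second one may spend
additional steps. -/
inductive ProgRel {n : ℕ} {α β : Type} (r : α → β → Prop) : SimProg n α → SimProg n β → Prop where
  | done {a b} (h : r a b) : ProgRel r (.done a) (.done b)
  | tick {c c'} {k k'} (hc : c ≤ c') (h : ProgRel r (k ()) (k' ())) :
      ProgRel r (.query (.tick c) k) (.query (.tick c') k')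
  | tick_right {c p} {k'} (h : ProgRel r p (k' ())) : ProgRel r p (.query (.tick c) k')
  | coin {k k'} (h : ∀ y, ProgRel r (k y) (k' y)) :
      ProgRel r (.query .coin k) (.query .coin k')
  | perm {x k k'} (h : ∀ y, ProgRel r (k y) (k' y)) :
      ProgRel r (.query (.perm x) k) (.query (.perm x) k')
  | permInv {x k k'} (h : ∀ y, ProgRel r (k y) (k' y)) :
      ProgRel r (.query (.permInv x) k) (.query (.permInv x) k')
  | abort {k k'} : ProgRel r (.query .abort k) (.query .abort k')

namespace ProgRel

variable {n : ℕ} {α β γ δ : Type}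

theorem bind {r : α → β → Prop} {s : γ → δ → Prop} {p : SimProg n α} {p' : SimProg n β}
    {f : α → SimProg n γ} {g : β → SimProg n δ} (h : ProgRel r p p')
    (hfg : ∀ a b, r a b → ProgRel s (f a) (g b)) :
    ProgRel s (OracleProg.bind p f) (OracleProg.bind p' g) := by
  induction h with
  | done h => exact hfg _ _ h
  | tick hc _ ih => exact .tick hc ih
  | tick_right _ ih => exact .tick_right ih
  | coin _ ih => exact .coin ih
  | perm _ ih => exact .perm ih
  | permInv _ ih => exact .permInv ih
  | abort => exact .abort

/-- Outcomes of runs: the first is aborted exactly when the second is, otherwise the results are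
related, and the first one takes at most as many steps. -/
def RunRel (r : α → β → Prop) (o : Option α × ℕ) (o' : Option β × ℕ) : Prop :=
  Option.Rel r o.1 o'.1 ∧ o.2 ≤ o'.2

/-- A syntactic comparison of programs gives a coupling of their runs: both use the same random
strings. -/
theorem coupled_run {r : α → β → Prop} {p : SimProg n α} {p' : SimProg n β}
    (h : ProgRel r p p') (P : Equiv.Perm (Word n × Word n)) :
    Coupled (RunRel r) (p.run P) (p'.run P) := by
  induction h with
  | done h => exact .pure ⟨.some h, le_rfl⟩
  | tick hc _ ih => exact ih.map fun a b h => ⟨h.1, add_le_add h.2 hc⟩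
  | @tick_right c _ _ _ ih =>
    have := ih.map (s := RunRel r) (f := id)
      (g := fun o : Option β × ℕ => (o.1, o.2 + c)) fun a b h => ⟨h.1, le_add_right h.2⟩
    rw [PMF.map_id] at this
    exact this
  | coin _ ih =>
    exact Coupled.bind_same _ fun y => (ih y).map fun a b h => ⟨h.1, Nat.succ_le_succ h.2⟩
  | perm _ ih => exact (ih _).map fun a b h => ⟨h.1, Nat.succ_le_succ h.2⟩
  | permInv _ ih => exact (ih _).map fun a b h => ⟨h.1, Nat.succ_le_succ h.2⟩
  | abort => exact .pure ⟨.none, le_rfl⟩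

end ProgRel

theorem Coupled.andThen {α β γ δ : Type} {r : α → β → Prop} {s : γ → δ → Prop}
    {μ : PMF (Option α × ℕ)} {ν : PMF (Option β × ℕ)}
    {f : α → PMF (Option γ × ℕ)} {g : β → PMF (Option δ × ℕ)}
    (h : Coupled (ProgRel.RunRel r) μ ν)
    (hfg : ∀ a b, r a b → Coupled (ProgRel.RunRel s) (f a) (g b)) :
    Coupled (ProgRel.RunRel s) (andThen μ f) (andThen ν g) := by
  refine h.bind ?_
  rintro ⟨o, c⟩ ⟨o', c'⟩ ⟨h1, h2⟩
  cases h1 with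
  | none => exact .pure ⟨.none, h2⟩
  | some hab => exact (hfg _ _ hab).map fun a b h => ⟨h.1, add_le_add h2 h.2⟩

/-! ### The distinguisher of the abbreviated model -/

namespace OracleProg

variable {Q : Type} {A : Q → Type} {α β : Type}

theorem eval_bind (O : (q : Q) → A q) (p : OracleProg Q A α) (f : α → OracleProg Q A β) :
    (p.bind f).eval O = (f (p.eval O)).eval O := by
  induction p with
  | done a => rfl
  | query q k ih => exact ih _

theorem Within.bind {post : α → ℕ → Prop} {post' : β → ℕ → Prop} {p : OracleProg Q A α}
    {f : α → OracleProg Q A β} {m : ℕ} (h : p.Within post m) (l : ℕ)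
    (hf : ∀ a r, post a r → (f a).Within post' (r + l)) : (p.bind f).Within post' (m + l) := by
  induction p generalizing m with
  | done a => exact hf a m h
  | query q k ih =>
    cases m with
    | zero => exact h.elim
    | succ m =>
      rw [Nat.succ_add]
      exact fun y => ih y (h y)

theorem Within.eval {post : α → ℕ → Prop} {p : OracleProg Q A α} {m : ℕ} (h : p.Within post m)
    (O : (q : Q) → A q) : ∃ r, post (p.eval O) r := by
  induction p generalizing m with
  | done a => exact ⟨m, h⟩
  | query q k ih =>
    cases m with
    | zero => exact h.elim
    | succ m => exact ih _ (h _)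

theorem AtMost.mono {p : OracleProg Q A α} {m m' : ℕ} (h : p.AtMost m) (hm : m ≤ m') :
    p.AtMost m' := by
  induction p generalizing m m' with
  | done a => exact trivial
  | query q k ih =>
    cases m with
    | zero => exact h.elim
    | succ m =>
      cases m' with
      | zero => omega
      | succ m' => exact fun y => ih y (h y) (Nat.le_of_succ_le_succ hm)

end OracleProg

/-- The first phase of a distinguisher, with its coins fixed. -/
abbrev FirstPhase (n : ℕ) : Type :=
  OracleProg (Term n) (fun _ => Word n) (Subversion n × (PubRand n → SecondPhase n))

namespace FirstPhase

variable {n : ℕ}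

/-- The subversion algorithm which repeats the first phase to find out which subversion
algorithm it publishes, and then runs that one. -/
def subversion (p : FirstPhase n) : Subversion n :=
  fun t => p.bind fun out => out.1 t

/-- Make the queries of the first phase in the second phase, and continue with the program that
belongs to the result. -/
def ask {α : Type} (f : α → SecondPhase n) :
    OracleProg (Term n) (fun _ => Word n) α → SecondPhase n
  | .done a => f a
  | .query t k => .query (.source t) fun y => ask f (k y)

/-- The distinguisher without coins which makes the queries of the first phase when it already
knows the public randomness. -/
def distinguisher (p : FirstPhase n) : AbbrDistinguisher n 0 :=
  fun _ R => ask (fun out => out.2 R) p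

theorem ask_atMost {α : Type} {post : α → ℕ → Prop} {f : α → SecondPhase n}
    {p : OracleProg (Term n) (fun _ => Word n) α} {m : ℕ} (h : p.Within post m)
    (hf : ∀ a r, post a r → (f a).AtMost r) : (ask f p).AtMost m := by
  induction p generalizing m with
  | done a => exact hf a m h
  | query t k ih =>
    cases m with
    | zero => exact h.elim
    | succ m => exact fun y => ih y (h y)

theorem eval_ask {α : Type} (F : Source n) (A : Subversion n) (R : PubRand n)
    (f : α → SecondPhase n) (p : OracleProg (Term n) (fun _ => Word n) α) :
    (ask f p).eval (realOracle F A R) = (f (p.eval F)).eval (realOracle F A R) := by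
  induction p with
  | done a => rfl
  | query t k ih => exact ih _

theorem apply_subversion (p : FirstPhase n) (F : Source n) :
    p.subversion.apply F = (p.eval F).1.apply F :=
  funext fun t => p.eval_bind F fun out => out.1 t

variable {q qA : ℕ} {ε : ℝ} {p : FirstPhase n}

theorem admissible_subversion
    (h : p.Within (fun out r => out.1.Admissible qA ε ∧ ∀ R, (out.2 R).AtMost r) q) :
    p.subversion.Admissible (qA + q) ε := by
  refine ⟨fun t => ?_, fun F i => ?_⟩
  · rw [add_comm]
    exact h.bind qA fun out r ho => (ho.1.1 t).mono (Nat.le_add_left _ _)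
  · obtain ⟨r, hr⟩ := h.eval F
    rw [apply_subversion]
    exact hr.1.2 F i

theorem atMost_distinguisher
    (h : p.Within (fun out r => out.1.Admissible qA ε ∧ ∀ R, (out.2 R).AtMost r) q) :
    p.distinguisher.AtMost q :=
  fun _ R => ask_atMost h fun _ _ ho => ho.2 R

theorem realOracle_congr {F : Source n} {A A' : Subversion n} (h : A.apply F = A'.apply F)
    (R : PubRand n) : realOracle F A R = realOracle F A' R := by
  funext q
  cases q with
  | source t => rfl
  | perm x => exact congrArg (fun G => feistel G R x) h
  | permInv x => exact congrArg (fun G => feistelInv G R x) h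

theorem abbrReal_distinguisher (p : FirstPhase n) :
    abbrReal p.distinguisher p.subversion = fullReal (m := 0) fun _ => p := by
  unfold abbrReal fullReal
  simp only [distinguisher, eval_ask, realOracle_congr (apply_subversion p _)]

end FirstPhase

/-! ### Two simulations of the subversion algorithm -/

/-- With the answers in the table `T`, the program returns `out`. -/
def Follows {n : ℕ} {α : Type} (T : Table n) (out : α) :
    OracleProg (Term n) (fun _ => Word n) α → Prop
  | .done a => a = out
  | .query t k => ∃ y, T.lookup t = some y ∧ Follows T out (k y)

/-- Every entry which is valid in `T₀` is valid in `T`. -/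
def Extends {n : ℕ} (T₀ T : Table n) : Prop :=
  ∀ t y, T₀.lookup t = some y → T.lookup t = some y

theorem Extends.cons {n : ℕ} {T₀ T : Table n} (h : Extends T₀ T) {t : Term n} {y : Word n}
    (ht : T₀.lookup t = none) : Extends T₀ ((t, y) :: T) := by
  intro t' y' h'
  rw [List.lookup_cons]
  by_cases e : t' = t
  · subst e; simp [h'] at ht
  · rw [beq_false_of_ne e]; exact h t' y' h'

theorem Extends.lookup_none {n : ℕ} {T₀ T : Table n} (h : Extends T₀ T) {t : Term n}
    (ht : T.lookup t = none) : T₀.lookup t = none := by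
  cases h' : T₀.lookup t with
  | none => rfl
  | some y => rw [h t y h'] at ht; cases ht

namespace Sim

variable {n : ℕ} {α β γ δ : Type}

/-- Started in the state `st`, the two computations make the same moves, except that the second
may spend additional steps; they end in the same state, whose table extends `T₀`. -/
def MRel (T₀ : Table n) (r : α → β → Prop) (st : SimState n) (m : M n α) (m' : M n β) : Prop :=
  ProgRel (fun a b => a.2 = b.2 ∧ Extends T₀ a.2.table ∧ r a.1 b.1) (m.run st) (m'.run st)

namespace MRel

variable {T₀ : Table n} {r : α → β → Prop} {s : γ → δ → Prop} {st : SimState n}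

theorem bind {m : M n α} {m' : M n β} {f : α → M n γ} {g : β → M n δ}
    (h : MRel T₀ r st m m')
    (hfg : ∀ st', Extends T₀ st'.table → ∀ a b, r a b → MRel T₀ s st' (f a) (g b)) :
    MRel T₀ s st (m >>= f) (m' >>= g) := by
  refine ProgRel.bind h ?_
  rintro ⟨a, st'⟩ ⟨b, _⟩ ⟨rfl, h2, h3⟩
  exact hfg st' h2 a b h3

theorem pure (hst : Extends T₀ st.table) {a : α} {b : β} (h : r a b) :
    MRel T₀ r st (Pure.pure a) (Pure.pure b) :=
  ProgRel.done ⟨rfl, hst, h⟩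

theorem get_bind {f : SimState n → M n γ} {g : SimState n → M n δ}
    (h : MRel T₀ s st (f st) (g st)) :
    MRel T₀ s st (get >>= f) (get >>= g) := h

theorem set_bind {st' : SimState n} {f : PUnit → M n γ} {g : PUnit → M n δ}
    (h : MRel T₀ s st' (f ⟨⟩) (g ⟨⟩)) :
    MRel T₀ s st (set st' >>= f) (set st' >>= g) := h

theorem set {st' : SimState n} (h : Extends T₀ st'.table) :
    MRel T₀ (fun _ _ => True) st (MonadStateOf.set st' : M n PUnit) (MonadStateOf.set st') :=
  ProgRel.done ⟨rfl, h, trivial⟩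

theorem modify_bind {u : SimState n → SimState n} {f : PUnit → M n γ} {g : PUnit → M n δ}
    (h : MRel T₀ s (u st) (f ⟨⟩) (g ⟨⟩)) :
    MRel T₀ s st (modify u >>= f) (modify u >>= g) := h

theorem tick_bind {c c' : ℕ} (hc : c ≤ c') {f : Unit → M n γ} {g : Unit → M n δ}
    (h : MRel T₀ s st (f ()) (g ())) :
    MRel T₀ s st (tick c >>= f) (tick c' >>= g) := ProgRel.tick hc h

theorem coin_bind {f : Word n → M n γ} {g : Word n → M n δ}
    (h : ∀ y, MRel T₀ s st (f y) (g y)) :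
    MRel T₀ s st (coin >>= f) (coin >>= g) := ProgRel.coin h

theorem perm_bind {x : Word n × Word n} {f : Word n × Word n → M n γ}
    {g : Word n × Word n → M n δ} (h : ∀ y, MRel T₀ s st (f y) (g y)) :
    MRel T₀ s st (perm x >>= f) (perm x >>= g) := ProgRel.perm h

theorem permInv_bind {x : Word n × Word n} {f : Word n × Word n → M n γ}
    {g : Word n × Word n → M n δ} (h : ∀ y, MRel T₀ s st (f y) (g y)) :
    MRel T₀ s st (permInv x >>= f) (permInv x >>= g) := ProgRel.permInv h

theorem abort : MRel T₀ r st Sim.abort Sim.abort := ProgRel.abort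

theorem abort_bind {f : α → M n γ} {g : β → M n δ} :
    MRel T₀ s st (Sim.abort >>= f) (Sim.abort >>= g) := ProgRel.abort

end MRel

/-- Query lists of two runs of the subversion algorithm: the second has more queries,
but only ones at terms of `T₀`. -/
def QueryRel (T₀ : Table n) (l l' : List (Term n)) : Prop :=
  l.length ≤ l'.length ∧ ∀ t, T₀.lookup t = none → (t ∈ l ↔ t ∈ l')

theorem QueryRel.cons {T₀ : Table n} {l l' : List (Term n)} (h : QueryRel T₀ l l') (t : Term n) :
    QueryRel T₀ (t :: l) (t :: l') :=
  ⟨Nat.succ_le_succ h.1, fun t' ht' => by simp only [List.mem_cons, h.2 t' ht']⟩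

/-- A repeated query of the first phase is invisible to the comparison. -/
theorem QueryRel.cons_right {T₀ : Table n} {l l' : List (Term n)} (h : QueryRel T₀ l l')
    {t : Term n} (ht : T₀.lookup t ≠ none) : QueryRel T₀ l (t :: l') :=
  ⟨h.1.trans (Nat.le_succ _), fun t' ht' => by
    have : t' ≠ t := fun e => ht (e ▸ ht')
    simp only [List.mem_cons, h.2 t' ht', this, false_or]⟩

variable {T₀ : Table n} {R : PubRand n} {st : SimState n}

theorem mrel_record (hst : Extends T₀ st.table) {t : Term n} (ht : st.table.lookup t = none)
    (y : Word n) : MRel T₀ (fun _ _ => True) st (record R t y) (record R t y) := by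
  unfold record
  exact .get_bind <| .tick_bind le_rfl <| .set (hst.cons (hst.lookup_none ht))

theorem mrel_inner (hst : Extends T₀ st.table) (t : Term n) :
    MRel T₀ Eq st (inner R t) (inner R t) := by
  unfold inner
  refine .tick_bind le_rfl <| .get_bind ?_
  cases h : st.table.lookup t with
  | some y => exact .pure hst rfl
  | none =>
    exact .coin_bind fun y => .bind (mrel_record hst h y) fun st' hst' _ _ _ => .pure hst' rfl

theorem mrel_runSub (hst : Extends T₀ st.table)
    (p : OracleProg (Term n) (fun _ => Word n) (Word n)) :
    MRel T₀ (fun a b => a.1 = b.1 ∧ QueryRel T₀ a.2 b.2) st (runSub R p) (runSub R p) := by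
  induction p generalizing st with
  | done y => exact .pure hst ⟨rfl, le_rfl, fun _ _ => Iff.rfl⟩
  | query t k ih =>
    refine .bind (mrel_inner hst t) ?_
    rintro st' hst' y _ rfl
    refine .bind (ih y hst') ?_
    rintro st' hst' a b ⟨h1, h2⟩
    exact .pure hst' ⟨h1, h2.cons t⟩

/-- Every query of the repeated first phase finds its recorded answer in the table, so the
repetition ends with the recorded result and leaves the state unchanged. -/
theorem mrel_runSub_bind {α : Type} {out : α} {p : OracleProg (Term n) (fun _ => Word n) α}
    (hp : Follows T₀ out p) (f : α → OracleProg (Term n) (fun _ => Word n) (Word n))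
    (hst : Extends T₀ st.table) :
    MRel T₀ (fun a b => a.1 = b.1 ∧ QueryRel T₀ a.2 b.2) st (runSub R (f out))
      (runSub R (p.bind f)) := by
  induction p generalizing st with
  | done a => cases hp; exact mrel_runSub hst _
  | query t k ih =>
    obtain ⟨y, hy, hp⟩ := hp
    refine ProgRel.tick_right ?_
    show ProgRel _ _ (OracleProg.bind ((match st.table.lookup t with
      | some y => (pure y : M n (Word n))
      | none => do let y ← coin; record R t y; pure y) st) _)
    rw [hst t y hy]
    have h1 := ProgRel.bind (f := .done)
      (s := fun a b => a.2 = b.2 ∧ Extends T₀ a.2.table ∧ a.1.1 = b.1.1 ∧ QueryRel T₀ a.1.2 b.1.2)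
      (g := fun r => .done ((r.1.1, t :: r.1.2), r.2)) (ih y hp hst) fun a b h =>
        .done ⟨h.1, h.2.1, h.2.2.1, h.2.2.2.cons_right (by simp [hy])⟩
    rw [OracleProg.bind_done] at h1
    exact h1

end Sim

namespace Sim

variable {n : ℕ} {T₀ : Table n} {R : PubRand n} {p : FirstPhase n}
  {out : Subversion n × (PubRand n → SecondPhase n)}

theorem mrel_subVal (hp : Follows T₀ out p) (i : ℕ) (x : Word n) {st : SimState n}
    (hst : Extends T₀ st.table) :
    MRel T₀ (fun a b => a.1 = b.1 ∧ QueryRel T₀ a.2 b.2) st (subVal R out.1 i x)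
      (subVal R p.subversion i x) := by
  unfold subVal
  refine .tick_bind le_rfl ?_
  cases slot n i with
  | none => exact .abort
  | some j => exact mrel_runSub_bind hp (fun o => o.1 (j, R.aff j x)) hst

theorem mrel_honestyCheck (hp : Follows T₀ out p) (i : ℕ) (l : List (Word n)) {st : SimState n}
    (hst : Extends T₀ st.table) :
    MRel T₀ Eq st (honestyCheck R out.1 i l) (honestyCheck R p.subversion i l) := by
  have main : ∀ (i : ℕ) (x : Word n) (xs : List (Word n)) {st : SimState n},
      (∀ i {st : SimState n}, Extends T₀ st.table → MRel T₀ Eq st (honestyCheck R out.1 i xs)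
        (honestyCheck R p.subversion i xs)) → Extends T₀ st.table →
      MRel T₀ Eq st
        (do let r ← subVal R out.1 i x
            let st ← get
            let b ← honestyCheck R out.1 (i + 1) xs
            pure (decide (roundVal R st.table i x = some r.1) && b))
        (do let r ← subVal R p.subversion i x
            let st ← get
            let b ← honestyCheck R p.subversion (i + 1) xs
            pure (decide (roundVal R st.table i x = some r.1) && b)) := by
    intro i x xs st ih hst
    refine .bind (mrel_subVal hp i x hst) ?_
    rintro st1 hst1 a b ⟨h1, -⟩
    refine .get_bind <| .bind (ih _ hst1) ?_
    rintro st2 hst2 c _ rfl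
    exact .pure hst2 (by rw [h1])
  induction l generalizing i st with
  | nil => exact .pure hst rfl
  | cons x xs ih =>
    cases xs with
    | nil => exact main i x [] (fun i st h => ih i h) hst
    | cons x' xs =>
      have := main (st := { st with checked := (i, x, x') :: st.checked }) i x (x' :: xs)
        (fun i st h => ih i h) hst
      exact this

/-- The related results of two evaluations along a chain. -/
def EvalRel (T₀ : Table n) (a b : Word n × Word n × List (ℕ × List (Term n))) : Prop :=
  a.1 = b.1 ∧ a.2.1 = b.2.1 ∧
    List.Forall₂ (fun e e' => e.1 = e'.1 ∧ QueryRel T₀ e.2 e'.2) a.2.2 b.2.2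

theorem mrel_evalForward (hp : Follows T₀ out p) (u fuel s : ℕ) (x x' : Word n) {st : SimState n}
    (hst : Extends T₀ st.table) :
    MRel T₀ (EvalRel T₀) st (evalForward R out.1 u fuel s x x')
      (evalForward R p.subversion u fuel s x x') := by
  induction fuel generalizing s x x' st with
  | zero =>
    unfold evalForward
    split_ifs
    · exact .pure hst ⟨rfl, rfl, .nil⟩
    all_goals exact .abort
  | succ fuel ih =>
    unfold evalForward
    split_ifs
    · exact .pure hst ⟨rfl, rfl, .nil⟩
    · exact .permInv_bind fun z => ih _ _ _ hst
    · refine .bind (mrel_subVal hp _ _ hst) ?_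
      rintro st1 hst1 ⟨a, l⟩ ⟨_, l'⟩ ⟨rfl, h1⟩
      refine .modify_bind <| .bind (ih _ _ _ (st := { st1 with completed := _ }) hst1) ?_
      rintro st2 hst2 c d ⟨h2, h3, h4⟩
      exact .pure hst2 ⟨h2, h3, .cons ⟨rfl, h1⟩ h4⟩

theorem mrel_evalBackward (hp : Follows T₀ out p) (u fuel s : ℕ) (x x' : Word n)
    {st : SimState n} (hst : Extends T₀ st.table) :
    MRel T₀ (EvalRel T₀) st (evalBackward R out.1 u fuel s x x')
      (evalBackward R p.subversion u fuel s x x') := by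
  induction fuel generalizing s x x' st with
  | zero =>
    unfold evalBackward
    split_ifs
    · exact .pure hst ⟨rfl, rfl, .nil⟩
    all_goals exact .abort
  | succ fuel ih =>
    unfold evalBackward
    split_ifs
    · exact .pure hst ⟨rfl, rfl, .nil⟩
    · exact .perm_bind fun z => ih _ _ _ hst
    · refine .bind (mrel_subVal hp _ _ hst) ?_
      rintro st1 hst1 ⟨a, l⟩ ⟨_, l'⟩ ⟨rfl, h1⟩
      refine .modify_bind <| .bind (ih _ _ _ (st := { st1 with completed := _ }) hst1) ?_
      rintro st2 hst2 c d ⟨h2, h3, h4⟩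
      exact .pure hst2 ⟨h2, h3, .cons ⟨rfl, h1⟩ h4⟩

theorem sum_length_le {Qs Qs' : List (ℕ × List (Term n))}
    (h : List.Forall₂ (fun e e' => e.1 = e'.1 ∧ QueryRel T₀ e.2 e'.2) Qs Qs') :
    (Qs.map fun e => e.2.length).sum ≤ (Qs'.map fun e => e.2.length).sum := by
  induction h with
  | nil => exact le_rfl
  | cons h _ ih => simpa using add_le_add h.2.1 ih

/-- Whether a term outside `T₀` was queried at another position does not depend on the additional
queries. -/
theorem exists_query_iff {Qs Qs' : List (ℕ × List (Term n))}
    (h : List.Forall₂ (fun e e' => e.1 = e'.1 ∧ QueryRel T₀ e.2 e'.2) Qs Qs')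
    {t : Term n} (ht : T₀.lookup t = none) (u : ℕ) :
    (∃ e ∈ Qs, e.1 ≠ u ∧ t ∈ e.2) ↔ ∃ e ∈ Qs', e.1 ≠ u ∧ t ∈ e.2 := by
  induction h with
  | nil => simp
  | cons h _ ih => simp only [List.exists_mem_cons_iff, ih, h.1, h.2.2 t ht]

/-- The terms that are adapted are not yet in the table, so that the first phase
has not queried them; this is why the additional queries cause no abort. -/
theorem mrel_adapt (hp : Follows T₀ out p) (u : ℕ) (w x y z : Word n)
    {Qs Qs' : List (ℕ × List (Term n))}
    (hQ : List.Forall₂ (fun e e' => e.1 = e'.1 ∧ QueryRel T₀ e.2 e'.2) Qs Qs') {st : SimState n}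
    (hst : Extends T₀ st.table) :
    MRel T₀ (fun _ _ => True) st (adapt R out.1 u w x y z Qs)
      (adapt R p.subversion u w x y z Qs') := by
  unfold adapt
  rcases slot n u with _ | i
  · exact .abort
  rcases slot n (u + 1) with _ | j
  · exact .abort
  refine .get_bind <| .tick_bind le_rfl ?_
  split_ifs with hc
  · exact .abort
  simp only [not_or, Bool.not_eq_true, Option.isSome_eq_false_iff, Option.isNone_iff_eq_none] at hc
  have hs := hst.lookup_none hc.1
  have ht := hst.lookup_none hc.2
  refine .set_bind <| .bind (mrel_subVal hp _ _ ((hst.cons hs).cons ht)) ?_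
  rintro st1 hst1 ⟨a, l⟩ ⟨_, l'⟩ ⟨rfl, h1⟩
  refine .bind (mrel_subVal hp _ _ hst1) ?_
  rintro st2 hst2 ⟨b, m⟩ ⟨_, m'⟩ ⟨rfl, h2⟩
  have hQ2 : List.Forall₂ (fun e e' => e.1 = e'.1 ∧ QueryRel T₀ e.2 e'.2)
      ((u, l) :: (u + 1, m) :: Qs) ((u, l') :: (u + 1, m') :: Qs') :=
    .cons ⟨rfl, h1⟩ (.cons ⟨rfl, h2⟩ hQ)
  split_ifs with h3
  · refine .modify_bind <| .tick_bind (sum_length_le hQ2) ?_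
    simp only [exists_query_iff hQ2 hs, exists_query_iff hQ2 ht]
    split_ifs
    · exact .abort
    · exact ProgRel.done ⟨rfl, hst2, trivial⟩
  · exact .abort_bind

theorem mrel_process (hp : Follows T₀ out p) (c : Chain n) {st : SimState n}
    (hst : Extends T₀ st.table) :
    MRel T₀ (fun _ _ => True) st (process R out.1 c) (process R p.subversion c) := by
  unfold process
  refine .get_bind <| .tick_bind le_rfl ?_
  by_cases hc : ∃ p ∈ pairs c.1 c.2, p ∈ st.completed ∨ p ∈ st.checked
  · rw [if_pos hc, if_pos hc]
    exact .pure hst trivial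
  rw [if_neg hc, if_neg hc]
  refine .bind (mrel_honestyCheck hp _ _ hst) ?_
  rintro st1 hst1 b _ rfl
  obtain ⟨s, l⟩ := c
  rcases b with _ | _
  · exact .pure hst1 trivial
  rcases l with _ | ⟨x, _ | ⟨x', l⟩⟩
  · exact .pure hst1 trivial
  · exact .pure hst1 trivial
  unfold complete
  refine .modify_bind <| .bind (mrel_evalForward hp _ _ _ _ _ hst1) ?_
  rintro st2 hst2 ⟨a1, a2, Q⟩ ⟨_, _, Q'⟩ ⟨rfl, rfl, h1⟩
  refine .bind (mrel_evalBackward hp _ _ _ _ _ hst2) ?_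
  rintro st3 hst3 ⟨b1, b2, Q1⟩ ⟨_, _, Q1'⟩ ⟨rfl, rfl, h2⟩
  exact mrel_adapt hp _ _ _ _ _ (List.rel_append h1 h2) hst3

theorem mrel_emptyQueue (hp : Follows T₀ out p) (fuel : ℕ) {st : SimState n}
    (hst : Extends T₀ st.table) :
    MRel T₀ (fun _ _ => True) st (emptyQueue R out.1 fuel) (emptyQueue R p.subversion fuel) := by
  induction fuel generalizing st with
  | zero => exact .abort
  | succ fuel ih =>
    unfold emptyQueue
    refine .get_bind ?_
    rcases h : st.queue with _ | ⟨c, rest⟩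
    · exact .pure hst trivial
    · exact .set_bind <| .bind (mrel_process hp c hst) fun st1 hst1 _ _ _ => ih hst1

theorem mrel_answer (hp : Follows T₀ out p) (t : Term n) {st : SimState n}
    (hst : Extends T₀ st.table) :
    MRel T₀ Eq st (answer R out.1 t) (answer R p.subversion t) := by
  unfold answer
  refine .bind (mrel_inner hst t) ?_
  rintro st1 hst1 y _ rfl
  exact .bind (mrel_emptyQueue hp _ hst1) fun st2 hst2 _ _ _ => .pure hst2 rfl

end Sim

/-- The state of the simulator of the abbreviated model. -/
abbrev RunState (n : ℕ) : Type := PubRand n × Subversion n × SimState n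

/-- The answers of the simulator of the abbreviated model, which are also the answers of the
lifted simulator in the second phase. -/
def secondAnswer {n : ℕ} (t : Term n) (st : RunState n) : SimProg n (Word n × RunState n) :=
  (chainSimulator n).answer t st

/-- The answers of the lifted simulator in the first phase. -/
def firstAnswer {n : ℕ} (t : Term n) (T : Table n) : SimProg n (Word n × Table n) :=
  (liftedSimulator n).answer₁ t T

/-- The start of the lifted simulator's second phase. -/
def liftedSetup {n : ℕ} (R : PubRand n) (A : Subversion n) (T : Table n) :
    SimProg n (RunState n) :=
  (liftedSimulator n).setup R A T

/-- The second phase of the ideal world does not depend on whether the published subversion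
algorithm is simulated directly or after a repetition of the first phase. -/
theorem coupled_idealSecond {n : ℕ} {T₀ : Table n} {R : PubRand n} {p : FirstPhase n}
    {out : Subversion n × (PubRand n → SecondPhase n)} (hp : Follows T₀ out p)
    (P : Equiv.Perm (Word n × Word n)) (D : SecondPhase n) {st : SimState n}
    (hst : Extends T₀ st.table) :
    Coupled (ProgRel.RunRel Eq) (idealSecond P secondAnswer D (R, out.1, st))
      (idealSecond P secondAnswer D (R, p.subversion, st)) := by
  induction D generalizing st with
  | done b => exact .pure ⟨.some rfl, le_rfl⟩
  | query q k ih =>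
    cases q with
    | perm x => exact ih _ hst
    | permInv x => exact ih _ hst
    | source t =>
      have h : ProgRel (fun a b => ∃ y st', Extends T₀ st'.table ∧ a = (y, R, out.1, st') ∧
          b = (y, R, p.subversion, st'))
          (secondAnswer t (R, out.1, st))
          (secondAnswer t (R, p.subversion, st)) := by
        refine ProgRel.bind (Sim.mrel_answer hp t hst) ?_
        rintro ⟨y, st'⟩ ⟨_, _⟩ ⟨rfl, h, rfl⟩
        exact .done ⟨y, st', h, rfl, rfl⟩
      refine (h.coupled_run P).andThen ?_
      rintro _ _ ⟨y, st', h, rfl, rfl⟩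
      exact ih _ h

/-! ### Unsubverted chains -/

namespace PubRand

variable {n : ℕ} (R : PubRand n) (i : Fin (8 * n))

theorem aff_affInv (z : Word n) : R.aff i (R.affInv i z) = z := by
  unfold aff affInv
  rw [Matrix.mulVec_mulVec, ← Units.val_mul, mul_inv_cancel, Units.val_one, Matrix.one_mulVec,
    sub_add_cancel]

theorem affInv_aff (x : Word n) : R.affInv i (R.aff i x) = x := by
  unfold aff affInv
  rw [add_sub_cancel_right, Matrix.mulVec_mulVec, ← Units.val_mul, inv_mul_cancel, Units.val_one,
    Matrix.one_mulVec]

end PubRand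

theorem two_le_trigLen (n : ℕ) : 2 ≤ trigLen n := le_max_left _ _

section

variable {n : ℕ} {R : PubRand n} {T T' : Table n}

theorem List.mem_of_lookup_eq_some {α β : Type*} [BEq α] [LawfulBEq α] {l : List (α × β)} {a : α}
    {b : β} (h : l.lookup a = some b) : (a, b) ∈ l := by
  obtain ⟨l₁, l₂, rfl, -⟩ := List.lookup_eq_some_iff.1 h
  simp

theorem exists_lookup_of_mem {e : Term n × Word n} (he : e ∈ T) :
    ∃ y, T.lookup e.1 = some y := by
  cases h : T.lookup e.1 with
  | some y => exact ⟨y, rfl⟩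
  | none => simpa using List.lookup_eq_none_iff.1 h e he

theorem mem_of_roundVal {i : ℕ} {x y : Word n} (h : roundVal R T i x = some y) :
    ∃ j : Fin (8 * n), j.val + 1 = i ∧ ((j, R.aff j x), y) ∈ T := by
  unfold roundVal slot at h
  split_ifs at h with hi
  · refine ⟨⟨i - 1, by omega⟩, by simp only; omega, List.mem_of_lookup_eq_some h⟩
  · cases h

theorem roundVal_affInv (t : Term n) :
    roundVal R T (t.1.val + 1) (R.affInv t.1 t.2) = T.lookup t := by
  have : slot n (t.1.val + 1) = some t.1 := by
    unfold slot
    rw [dif_pos (by omega)]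
    rfl
  simp only [roundVal, this, Option.bind_some, PubRand.aff_affInv]

theorem mem_column_iff {i : ℕ} {x : Word n} :
    x ∈ column R T i ↔ ∃ e ∈ T, e.1.1.val + 1 = i ∧ R.affInv e.1.1 e.1.2 = x := by
  unfold column
  rw [List.mem_filterMap]
  refine exists_congr fun e => and_congr_right fun _ => ?_
  split_ifs with h <;> simp [h]

theorem mem_column_of_roundVal {i : ℕ} {x y : Word n} (h : roundVal R T i x = some y) :
    x ∈ column R T i := by
  obtain ⟨j, hj, hm⟩ := mem_of_roundVal h
  exact mem_column_iff.2 ⟨_, hm, hj, R.affInv_aff j x⟩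

theorem roundVal_mono (h : Extends T T') {i : ℕ} {x y : Word n}
    (hy : roundVal R T i x = some y) : roundVal R T' i x = some y := by
  unfold roundVal at *
  cases hs : slot n i with
  | none => simp [hs] at hy
  | some j =>
    rw [hs] at hy
    exact h _ _ hy

/-- Beginning with `x 0`, `x 1` at the positions `s`, `s + 1`, the `m + 1` elements
`x 0, …, x m` form an unsubverted chain in the table.  The element `x (m + 1)` at the next position
is included for convenience; its value need not be in the table. -/
def IsLongChain (R : PubRand n) (T : Table n) (s m : ℕ) (x : ℕ → Word n) : Prop :=
  (∃ y, roundVal R T s (x 0) = some y) ∧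
    ∀ k < m, ∃ y, roundVal R T (s + 1 + k) (x (k + 1)) = some y ∧ x (k + 2) = x k + y

theorem IsLongChain.mono (h : Extends T T') {s m : ℕ} {x : ℕ → Word n}
    (hx : IsLongChain R T s m x) :
    IsLongChain R T' s m x :=
  ⟨hx.1.imp fun _ hy => roundVal_mono h hy, fun k hk =>
    (hx.2 k hk).imp fun _ hy => ⟨roundVal_mono h hy.1, hy.2⟩⟩

/-- A walk to the right succeeds if and only if it is part of a sequence which satisfies the
recurrence of the Feistel network with defined values. -/
theorem walkRight_isSome_iff {m i : ℕ} {a b : Word n} :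
    (walkRight R T m i a b).isSome ↔ ∃ x : ℕ → Word n, x 0 = a ∧ x 1 = b ∧
      ∀ k < m, ∃ y, roundVal R T (i + k) (x (k + 1)) = some y ∧ x (k + 2) = x k + y := by
  induction m generalizing i a b with
  | zero => simpa [walkRight] using ⟨fun k => if k = 0 then a else b, by simp, by simp⟩
  | succ m ih =>
    unfold walkRight
    constructor
    · intro h
      rw [Option.isSome_bind, Option.any_eq_true] at h
      obtain ⟨y, hy, h⟩ := h
      rw [Option.isSome_map, ih] at h
      obtain ⟨x, h0, h1, h⟩ := h
      refine ⟨fun k => k.casesOn a x, rfl, h0, ?_⟩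
      rintro (_ | k) hk
      · exact ⟨y, (show roundVal R T i (x 0) = some y by rw [h0, hy]), h1⟩
      · obtain ⟨y', hy', h'⟩ := h k (Nat.lt_of_succ_lt_succ hk)
        exact ⟨y', by rw [← hy']; congr 1; omega, h'⟩
    · rintro ⟨x, rfl, rfl, h⟩
      obtain ⟨y, hy, h2⟩ := h 0 m.succ_pos
      rw [Option.isSome_bind, Option.any_eq_true]
      refine ⟨y, hy, ?_⟩
      rw [Option.isSome_map, ih]
      refine ⟨fun k => x (k + 1), rfl, h2, fun k hk => ?_⟩
      obtain ⟨y', hy', h'⟩ := h (k + 1) (Nat.succ_lt_succ hk)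
      exact ⟨y', by rw [← hy']; congr 1; omega, h'⟩

/-- A walk to the left, as a sequence indexed from right to left. -/
theorem exists_of_walkLeft_isSome {m i : ℕ} {a b : Word n}
    (h : (walkLeft R T m i a b).isSome) : ∃ x : ℕ → Word n, x 0 = a ∧ x 1 = b ∧
      ∀ k < m, ∃ y, roundVal R T (i - k) (x (k + 1)) = some y ∧ x (k + 2) = x k + y := by
  induction m generalizing i a b with
  | zero => simpa using ⟨fun k => if k = 0 then a else b, by simp, by simp⟩
  | succ m ih =>
    unfold walkLeft at h
    rw [Option.isSome_bind, Option.any_eq_true] at h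
    obtain ⟨y, hy, h⟩ := h
    rw [Option.isSome_map] at h
    obtain ⟨x, h0, h1, h⟩ := ih h
    refine ⟨fun k => k.casesOn a x, rfl, h0, ?_⟩
    rintro (_ | k) hk
    · exact ⟨y, (show roundVal R T i (x 0) = some y by rw [h0, hy]), h1⟩
    · obtain ⟨y', hy', h'⟩ := h k (Nat.lt_of_succ_lt_succ hk)
      exact ⟨y', by rw [← hy']; congr 1; omega, h'⟩

theorem hasLongChain_iff :
    hasLongChain R T = true ↔ ∃ s x, IsLongChain R T s (trigLen n - 1) x := by
  have h2 := two_le_trigLen n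
  unfold hasLongChain
  simp only [List.any_eq_true, walkRight_isSome_iff, mem_column_iff]
  constructor
  · rintro ⟨e, he, -, -, x, h0, -, h⟩
    refine ⟨e.1.1.val + 1, x, ?_, h⟩
    rw [h0, roundVal_affInv]
    exact exists_lookup_of_mem he
  · rintro ⟨s, x, ⟨y, hy⟩, h⟩
    obtain ⟨j, rfl, hm⟩ := mem_of_roundVal hy
    obtain ⟨y1, hy1, -⟩ := h 0 (by omega)
    exact ⟨_, hm, x 1, mem_column_iff.1 (mem_column_of_roundVal hy1), x,
      (R.affInv_aff j (x 0)).symm, rfl, h⟩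

theorem hasLongChain_mono (h : Extends T T') (hT : hasLongChain R T = true) :
    hasLongChain R T' = true := by
  rw [hasLongChain_iff] at *
  obtain ⟨s, x, hx⟩ := hT
  exact ⟨s, x, hx.mono h⟩

/-- A chain that reaches a new term from the left is a long chain, read backwards. -/
theorem hasLongChain_of_walkLeft {i : ℕ} {a b y : Word n} (hy : roundVal R T i a = some y)
    (h : (walkLeft R T (trigLen n - 1) (i - 1) a b).isSome) : hasLongChain R T = true := by
  have h2 := two_le_trigLen n
  obtain ⟨z, rfl, -, hz⟩ := exists_of_walkLeft_isSome h
  obtain ⟨m, hm⟩ : ∃ m, trigLen n - 1 = m + 1 := ⟨trigLen n - 2, by omega⟩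
  rw [hm] at hz
  -- The leftmost position is at least 1, so that the subtractions do not truncate.
  have hi : m + 2 ≤ i := by
    obtain ⟨y', hy', -⟩ := hz m (by omega)
    obtain ⟨j, hj, -⟩ := mem_of_roundVal hy'
    omega
  rw [hasLongChain_iff, hm]
  refine ⟨i - (m + 1), fun k => if k ≤ m + 1 then z (m + 1 - k) else z 1 + y, ?_, ?_⟩
  · obtain ⟨y', hy', -⟩ := hz m (by omega)
    exact ⟨y', by rw [← hy']; congr 1; omega⟩
  · intro k hk
    rcases Nat.lt_or_eq_of_le (Nat.le_of_lt_succ hk) with hk | rfl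
    · obtain ⟨y', hy', h'⟩ := hz (m - 1 - k) (by omega)
      refine ⟨y', ?_, ?_⟩
      · beta_reduce
        rw [if_pos (by omega), ← hy']
        congr 1
        · omega
        · congr 1; omega
      · beta_reduce
        rw [if_pos (by omega), if_pos (by omega), show m + 1 - (k + 2) = m - 1 - k by omega,
          show m + 1 - k = m - 1 - k + 2 by omega, h', add_assoc,
          show y' + y' = 0 from funext fun _ => CharTwo.add_self_eq_zero _, add_zero]
    · refine ⟨y, ?_, ?_⟩
      · beta_reduce
        rw [if_pos le_rfl, ← hy]
        congr 1
        · omega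
        · congr 1; omega
      · beta_reduce
        rw [if_neg (by omega), if_pos (by omega), show k + 1 - k = 1 by omega]

/-- Without a long chain in the table, recording a term enqueues nothing. -/
theorem newChains_eq_nil {t : Term n} {y : Word n} (h : hasLongChain R ((t, y) :: T) = false) :
    newChains R ((t, y) :: T) (t.1.val + 1) (R.affInv t.1 t.2) = [] := by
  have ht : roundVal R ((t, y) :: T) (t.1.val + 1) (R.affInv t.1 t.2) = some y := by
    rw [roundVal_affInv, List.lookup_cons_self]
  unfold newChains
  rw [List.append_eq_nil_iff, List.filterMap_eq_nil_iff, List.filterMap_eq_nil_iff]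
  constructor
  · intro b hb
    rw [Option.map_eq_none_iff, ← Option.not_isSome_iff_eq_none]
    intro hw
    rw [hasLongChain_of_walkLeft ht hw] at h
    cases h
  · intro b hb
    rw [Option.map_eq_none_iff, ← Option.not_isSome_iff_eq_none]
    intro hw
    have : hasLongChain R ((t, y) :: T) = true := by
      unfold hasLongChain
      rw [List.any_eq_true]
      exact ⟨(t, y), List.mem_cons_self, List.any_eq_true.2 ⟨b, hb, hw⟩⟩
    rw [this] at h
    cases h

end

/-! ### The probability of a long chain -/

section

variable {n : ℕ}

/-- The coordinates of the public randomness other than the vectors `b i` of the rounds with index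
`j + 2, …, j + d + 1`. -/
def offRounds (j d : ℕ) (R : PubRand n) :
    (Fin (8 * n) → Matrix.GeneralLinearGroup (Fin n) (ZMod 2)) ×
      ({i : Fin (8 * n) // ¬ (j + 2 ≤ i.val ∧ i.val < j + 2 + d)} → Word n) :=
  (fun i => (R i).1, fun i => (R i.1).2)

/-- The matrix `a i`, and the preimage of one point, determine the vector `b i`. -/
theorem snd_eq_of_affInv_eq {R R' : PubRand n} {i : Fin (8 * n)} {z : Word n}
    (h1 : (R i).1 = (R' i).1) (h2 : R.affInv i z = R'.affInv i z) : (R i).2 = (R' i).2 := by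
  have h := R.aff_affInv i z
  have h' := R'.aff_affInv i z
  rw [← h2] at h'
  have h3 := h.trans h'.symm
  rw [PubRand.aff, PubRand.aff, h1] at h3
  exact add_left_cancel h3

theorem affInv_congr {R R' : PubRand n} {i : Fin (8 * n)} (h : R i = R' i) (z : Word n) :
    R.affInv i z = R'.affInv i z := by
  rw [PubRand.affInv, PubRand.affInv, h]

/-- The entries `e 0, …, e (d + 1)` form an unsubverted chain, beginning at the round with
index `j`. -/
def EntriesChain (R : PubRand n) (j d : ℕ) (e : ℕ → Term n × Word n) : Prop :=
  (∀ k < d + 2, (e k).1.1.val = j + k) ∧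
    ∀ k < d, R.affInv (e (k + 2)).1.1 (e (k + 2)).1.2 =
      R.affInv (e k).1.1 (e k).1.2 + (e (k + 1)).2

/-- Along a chain of given entries, the elements after the second one are determined by the
previous ones, and together with the matrices they determine the vectors `b i`. -/
theorem EntriesChain.injOn (j d : ℕ) (e : ℕ → Term n × Word n) :
    Set.InjOn (offRounds j d) {R : PubRand n | EntriesChain R j d e} := by
  intro R hR R' hR' h
  have ha : ∀ i, (R i).1 = (R' i).1 := fun i => congrFun (congrArg Prod.fst h) i
  have hb : ∀ i : Fin (8 * n), ¬ (j + 2 ≤ i.val ∧ i.val < j + 2 + d) → (R i).2 = (R' i).2 :=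
    fun i hi => congrFun (congrArg Prod.snd h) ⟨i, hi⟩
  have hx : ∀ k < d + 2, R.affInv (e k).1.1 (e k).1.2 = R'.affInv (e k).1.1 (e k).1.2 := by
    intro k
    induction k using Nat.strong_induction_on with
    | _ k ih =>
      intro hk
      by_cases h2 : k < 2
      · have := hR.1 k hk
        exact affInv_congr (Prod.ext (ha _) (hb _ (by omega))) _
      · obtain ⟨k, rfl⟩ : ∃ l, k = l + 2 := ⟨k - 2, by omega⟩
        rw [hR.2 k (by omega), hR'.2 k (by omega), ih k (by omega) (by omega)]
  funext i
  refine Prod.ext (ha i) ?_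
  by_cases hi : j + 2 ≤ i.val ∧ i.val < j + 2 + d
  · have h1 := hR.1 (i.val - j) (by omega)
    have h2 : (e (i.val - j)).1.1 = i := Fin.ext (by omega)
    have h3 := hx (i.val - j) (by omega)
    rw [h2] at h3
    exact snd_eq_of_affInv_eq (ha i) h3
  · exact hb i hi

/-- Each of the `d` equations of a chain of given entries loses a factor `2 ^ n`. -/
theorem EntriesChain.card_le (j d : ℕ) (e : ℕ → Term n × Word n) :
    Nat.card {R : PubRand n // EntriesChain R j d e} * (2 ^ n) ^ d ≤ Nat.card (PubRand n) := by
  classical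
  by_cases hne : ∃ R : PubRand n, EntriesChain R j d e
  · obtain ⟨R, hR⟩ := hne
    have hj : j + 1 + d < 8 * n := by
      have := hR.1 (d + 1) (by omega)
      have := (e (d + 1)).1.1.isLt
      omega
    have hc : Fintype.card {i : Fin (8 * n) // ¬ (j + 2 ≤ i.val ∧ i.val < j + 2 + d)} + d
        = 8 * n := by
      have h1 : Fintype.card {i : Fin (8 * n) // j + 2 ≤ i.val ∧ i.val < j + 2 + d} = d := by
        let eqv : {i : Fin (8 * n) // j + 2 ≤ i.val ∧ i.val < j + 2 + d} ≃ Fin d :=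
          { toFun := fun i => ⟨i.1.val - (j + 2), by have := i.2; omega⟩
            invFun := fun k => ⟨⟨j + 2 + k.val, by omega⟩, by simp⟩
            left_inv := fun i => Subtype.ext (Fin.ext (by have := i.2; simp only; omega))
            right_inv := fun k => Fin.ext (by simp) }
        rw [Fintype.card_congr eqv, Fintype.card_fin]
      have h2 := Fintype.card_subtype_compl
        (fun i : Fin (8 * n) => j + 2 ≤ i.val ∧ i.val < j + 2 + d)
      have h3 := Fintype.card_subtype_le
        (fun i : Fin (8 * n) => j + 2 ≤ i.val ∧ i.val < j + 2 + d)
      rw [h1, Fintype.card_fin] at h2 h3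
      omega
    have hw : Nat.card (Word n) = 2 ^ n := by simp
    have h3 : Nat.card (PubRand n) =
        Nat.card (Matrix.GeneralLinearGroup (Fin n) (ZMod 2)) ^ (8 * n) *
          Nat.card (Word n) ^ (8 * n) := by
      rw [← mul_pow, ← Nat.card_prod]
      exact Nat.card_fun.trans (by rw [Nat.card_fin])
    have h1 := Nat.card_le_card_of_injective _ (EntriesChain.injOn j d e).injective
    calc _ ≤ _ := Nat.mul_le_mul_right _ h1
      _ = Nat.card (PubRand n) := by
        rw [h3, Nat.card_prod, Nat.card_fun, Nat.card_fun (α := {i : Fin (8 * n) // _}),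
          ← hw, mul_assoc, ← pow_add, Nat.card_eq_fintype_card (α := {i : Fin (8 * n) // _}), hc,
          Nat.card_fin]
  · have : IsEmpty {R : PubRand n // EntriesChain R j d e} := ⟨fun R => hne ⟨R.1, R.2⟩⟩
    simp

/-- A long chain is given by a sequence of `trigLen n` entries of the table. -/
theorem exists_entriesChain {R : PubRand n} {T : Table n} (h : hasLongChain R T = true) :
    ∃ v : Fin (trigLen n) → Fin T.length, ∃ j, ∀ e : ℕ → Term n × Word n,
      (∀ k : Fin (trigLen n), e k = T.get (v k)) → EntriesChain R j (trigLen n - 2) e := by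
  have h2 := two_le_trigLen n
  obtain ⟨s, x, ⟨y0, hy0⟩, hx⟩ := hasLongChain_iff.1 h
  have key : ∀ k : Fin (trigLen n), ∃ l : Fin T.length, ∃ y,
      roundVal R T (s + k) (x k) = some y ∧ (T.get l).1.1.val + 1 = s + k ∧ (T.get l).2 = y ∧
      R.affInv (T.get l).1.1 (T.get l).1.2 = x k := by
    intro k
    have : ∃ y, roundVal R T (s + k) (x k) = some y := by
      obtain ⟨_ | k, hk⟩ := k
      · exact ⟨y0, hy0⟩
      · obtain ⟨y, hy, -⟩ := hx k (by omega)
        exact ⟨y, by rw [← hy]; congr 1; simp only; omega⟩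
    obtain ⟨y, hy⟩ := this
    obtain ⟨i, hi, hm⟩ := mem_of_roundVal hy
    obtain ⟨l, hl⟩ := List.mem_iff_get.1 hm
    refine ⟨l, y, hy, ?_, ?_, ?_⟩ <;> rw [hl]
    · exact hi
    · exact R.affInv_aff i _
  choose v y hy hs hv hxv using key
  have hs1 : 1 ≤ s := by
    have := hs ⟨0, by omega⟩
    simp only at this
    omega
  refine ⟨v, s - 1, fun e he => ⟨fun k hk => ?_, fun k hk => ?_⟩⟩
  · have := hs ⟨k, by omega⟩
    rw [he ⟨k, by omega⟩]
    simp only at this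
    omega
  · rw [he ⟨k, by omega⟩, he ⟨k + 1, by omega⟩, he ⟨k + 2, by omega⟩, hxv, hxv, hv]
    obtain ⟨y', hy', h'⟩ := hx k (by omega)
    have h1 := hy ⟨k + 1, by omega⟩
    rw [show s + 1 + k = s + (k + 1) by omega, h1] at hy'
    rw [Option.some_injective _ hy']
    exact h'

/-- The entries of a table selected by `v`, as a sequence. -/
def selected (T : Table n) (v : Fin (trigLen n) → Fin T.length) (k : ℕ) : Term n × Word n :=
  T.get (v ⟨min k (trigLen n - 1), by have := two_le_trigLen n; omega⟩)

/-- The union bound over all sequences of `trigLen n` entries. -/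
theorem card_hasLongChain_le (T : Table n) :
    Nat.card {R : PubRand n // hasLongChain R T = true} * (2 ^ n) ^ (trigLen n - 2) ≤
      T.length ^ trigLen n * Nat.card (PubRand n) := by
  have h1 : Nat.card {R : PubRand n // hasLongChain R T = true} ≤
      Nat.card (Σ v : Fin (trigLen n) → Fin T.length, {R : PubRand n //
        EntriesChain R (selected T v 0).1.1.val (trigLen n - 2) (selected T v)}) := by
    have key : ∀ R : {R : PubRand n // hasLongChain R T = true}, ∃ v,
        EntriesChain R.1 (selected T v 0).1.1.val (trigLen n - 2) (selected T v) := by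
      intro R
      obtain ⟨v, j, h⟩ := exists_entriesChain R.2
      have h2 := h (selected T v) fun k => by
        unfold selected
        congr 2
        exact Fin.ext (min_eq_left (by omega))
      refine ⟨v, ?_⟩
      rwa [h2.1 0 (by omega)]
    choose v hv using key
    refine Nat.card_le_card_of_injective (fun R => ⟨v R, R.1, hv R⟩) fun R R' h => Subtype.ext ?_
    have := congrArg (fun p : (Σ v : Fin (trigLen n) → Fin T.length, {R : PubRand n //
        EntriesChain R (selected T v 0).1.1.val (trigLen n - 2) (selected T v)}) => p.2.1) h
    exact this
  calc _ ≤ _ := Nat.mul_le_mul_right _ h1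
    _ = ∑ v : Fin (trigLen n) → Fin T.length, Nat.card {R : PubRand n //
          EntriesChain R (selected T v 0).1.1.val (trigLen n - 2) (selected T v)} *
            (2 ^ n) ^ (trigLen n - 2) := by
      rw [Nat.card_sigma, Finset.sum_mul]
    _ ≤ ∑ _v : Fin (trigLen n) → Fin T.length, Nat.card (PubRand n) :=
      Finset.sum_le_sum fun v _ => EntriesChain.card_le _ _ _
    _ = _ := by simp

/-- The bound for the probability of a long chain among `q` terms. -/
noncomputable def chainBound (n q : ℕ) : ℝ :=
  8 * (n : ℝ) * (q : ℝ) ^ ((n : ℝ) / 10) * (2 : ℝ) ^ (2 * (n : ℝ) - (n : ℝ) ^ 2 / 10)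

theorem chainBound_nonneg (n q : ℕ) : 0 ≤ chainBound n q := by
  unfold chainBound
  positivity

/-- The estimate `(2 ^ n) ^ 2 * (t / 2 ^ n) ^ trigLen n` of the union bound is at most
`chainBound n q`. The factor `8 * n` is at least one, except for `n = 0`, where there are no terms. -/
theorem le_chainBound {t q : ℕ} (htq : t ≤ q) (hn : n = 0 → t = 0) {x : ℝ} (h1 : x ≤ 1)
    (hx : x * ((2 : ℝ) ^ n) ^ (trigLen n - 2) ≤ (t : ℝ) ^ trigLen n) : x ≤ chainBound n q := by
  have hr := two_le_trigLen n
  rcases Nat.eq_zero_or_pos n with rfl | hn0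
  · rw [hn rfl, Nat.cast_zero, zero_pow (by omega), pow_zero, one_pow, mul_one] at hx
    exact hx.trans (chainBound_nonneg _ _)
  have hN : (0 : ℝ) < (2 : ℝ) ^ n := by positivity
  have e : chainBound n q =
      8 * (n : ℝ) * ((2 : ℝ) ^ n) ^ 2 * ((q : ℝ) / 2 ^ n) ^ ((n : ℝ) / 10) := by
    have e1 : (2 : ℝ) ^ (2 * (n : ℝ) - (n : ℝ) ^ 2 / 10) =
        ((2 : ℝ) ^ n) ^ 2 / ((2 : ℝ) ^ n) ^ ((n : ℝ) / 10) := by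
      have e2 : (2 : ℝ) ^ ((n : ℝ) ^ 2 / 10) = ((2 : ℝ) ^ n) ^ ((n : ℝ) / 10) := by
        rw [← Real.rpow_natCast 2 n, ← Real.rpow_mul two_pos.le, sq, mul_div_assoc]
      rw [Real.rpow_sub two_pos, e2, mul_comm 2 (n : ℝ), Real.rpow_mul two_pos.le,
        Real.rpow_natCast, Real.rpow_two]
    rw [chainBound, e1, Real.div_rpow q.cast_nonneg hN.le]
    ring
  have h8 : (1 : ℝ) ≤ 8 * n := by
    have : (1 : ℝ) ≤ n := by exact_mod_cast hn0
    linarith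
  rw [e]
  -- For `q > 2 ^ n` the bound exceeds one; for smaller `q` the exponent `trigLen n` may be lowered
  -- to `n / 10`, since the base is at most one.
  rcases le_or_gt (q : ℝ) (2 ^ n) with hq | hq
  · have hq1 : (q : ℝ) / 2 ^ n ≤ 1 := (div_le_one hN).2 hq
    have hq0 : (0 : ℝ) ≤ (q : ℝ) / 2 ^ n := by positivity
    have h2 : x ≤ ((2 : ℝ) ^ n) ^ 2 * ((q : ℝ) / 2 ^ n) ^ trigLen n := by
      have h3 : (t : ℝ) ^ trigLen n ≤ (q : ℝ) ^ trigLen n := by gcongr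
      rw [div_pow, ← mul_div_assoc, le_div_iff₀ (by positivity)]
      calc x * ((2 : ℝ) ^ n) ^ trigLen n
          = x * ((2 : ℝ) ^ n) ^ (trigLen n - 2) * ((2 : ℝ) ^ n) ^ 2 := by
            rw [mul_assoc, ← pow_add, Nat.sub_add_cancel hr]
        _ ≤ (q : ℝ) ^ trigLen n * ((2 : ℝ) ^ n) ^ 2 := by gcongr; exact hx.trans h3
        _ = _ := mul_comm _ _
    have h4 : ((q : ℝ) / 2 ^ n) ^ trigLen n ≤ ((q : ℝ) / 2 ^ n) ^ ((n : ℝ) / 10) := by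
      rw [← Real.rpow_natCast]
      refine Real.rpow_le_rpow_of_exponent_ge_of_imp hq0 hq1 ?_ ?_
      · have : n ≤ 10 * trigLen n := by unfold trigLen; omega
        have : (n : ℝ) ≤ 10 * trigLen n := by exact_mod_cast this
        linarith
      · intro _ h0
        have : (2 : ℝ) ≤ trigLen n := by exact_mod_cast hr
        linarith
    calc x ≤ 1 * ((2 : ℝ) ^ n) ^ 2 * ((q : ℝ) / 2 ^ n) ^ trigLen n := by rwa [one_mul]
      _ ≤ _ := by gcongr
  · have h2 : (1 : ℝ) ≤ ((q : ℝ) / 2 ^ n) ^ ((n : ℝ) / 10) :=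
      Real.one_le_rpow ((one_le_div hN).2 hq.le) (by positivity)
    have h3 : (1 : ℝ) ≤ ((2 : ℝ) ^ n) ^ 2 := one_le_pow₀ (one_le_pow₀ one_le_two)
    calc x ≤ 1 * 1 * 1 := by simpa using h1
      _ ≤ _ := by gcongr

theorem prob_hasLongChain_le (T : Table n) {q : ℕ} (hT : T.length ≤ q) :
    (PMF.uniformOfFintype (PubRand n)).toOuterMeasure {R | hasLongChain R T = true} ≤
      ENNReal.ofReal (chainBound n q) := by
  rw [PMF.toOuterMeasure_uniformOfFintype_apply, ← Nat.card_eq_fintype_card,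
    ← Nat.card_eq_fintype_card]
  have hpos : 0 < Nat.card (PubRand n) := Nat.card_pos
  have hcard := card_hasLongChain_le T
  have hle : Nat.card {R : PubRand n // hasLongChain R T = true} ≤ Nat.card (PubRand n) :=
    Nat.card_le_card_of_injective _ Subtype.val_injective
  have hpos' : (0 : ℝ) < Nat.card (PubRand n) := by exact_mod_cast hpos
  have h := le_chainBound (n := n) (t := T.length) (q := q)
    (x := (Nat.card {R : PubRand n // hasLongChain R T = true} : ℝ) / Nat.card (PubRand n)) hT
    (by
      rintro rfl
      cases T with
      | nil => rfl
      | cons e T => exact Fin.elim0 e.1.1)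
    ((div_le_one hpos').2 (by exact_mod_cast hle))
    (by
      rw [div_mul_eq_mul_div, div_le_iff₀ hpos']
      exact_mod_cast hcard)
  refine le_trans (le_of_eq ?_) (ENNReal.ofReal_le_ofReal h)
  rw [ENNReal.ofReal_div_of_pos hpos', ENNReal.ofReal_natCast, ENNReal.ofReal_natCast]
  rfl

end

/-! ### Runs of composed programs -/

section

variable {α β γ δ : Type}

theorem pure_andThen (a : α) (c : ℕ) (f : α → PMF (Option β × ℕ)) :
    andThen (PMF.pure (some a, c)) f = (f a).map fun r => (r.1, c + r.2) :=
  PMF.pure_bind _ _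

theorem bind_andThen (μ : PMF γ) (h : γ → PMF (Option α × ℕ)) (f : α → PMF (Option β × ℕ)) :
    andThen (μ.bind h) f = μ.bind fun y => andThen (h y) f :=
  PMF.bind_bind _ _ _

theorem andThen_assoc (μ : PMF (Option α × ℕ)) (f : α → PMF (Option β × ℕ))
    (g : β → PMF (Option γ × ℕ)) :
    andThen (andThen μ f) g = andThen μ fun a => andThen (f a) g := by
  unfold andThen
  rw [PMF.bind_bind]
  congr 1
  funext o
  rcases o with ⟨_ | a, c⟩
  · simp only [PMF.pure_bind]
  · simp only [PMF.bind_map, PMF.map_bind]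
    congr 1
    funext o
    rcases o with ⟨_ | b, c'⟩
    · simp only [Function.comp_apply, PMF.pure_map]
    · simp only [Function.comp_apply, PMF.map_comp]
      congr 1
      funext r
      simp only [Function.comp_apply, add_assoc]

theorem map_andThen_add (μ : PMF (Option α × ℕ)) (c : ℕ) (f : α → PMF (Option β × ℕ)) :
    andThen (μ.map fun r => (r.1, c + r.2)) f =
      (andThen μ f).map fun r => (r.1, c + r.2) := by
  unfold andThen
  rw [PMF.bind_map, PMF.map_bind]
  congr 1
  funext o
  rcases o with ⟨_ | a, c'⟩
  · simp only [Function.comp_apply, PMF.pure_map]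
  · simp only [Function.comp_apply, PMF.map_comp]
    congr 1
    funext r
    simp only [Function.comp_apply, add_assoc]

variable {n : ℕ}

theorem run_bind (P : Equiv.Perm (Word n × Word n)) (p : SimProg n α) (f : α → SimProg n β) :
    SimProg.run P (OracleProg.bind p f) = andThen (p.run P) fun a => (f a).run P := by
  induction p with
  | done a =>
    rw [SimProg.run, pure_andThen]
    simp only [zero_add]
    exact (PMF.map_id _).symm
  | query q k ih =>
    have hm : ∀ (μ : PMF (Option α × ℕ)) (c : ℕ),
        (andThen μ fun a => (f a).run P).map (fun r => (r.1, r.2 + c)) =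
          andThen (μ.map fun r => (r.1, r.2 + c)) fun a => (f a).run P := by
      intro μ c
      simp only [add_comm _ c]
      exact (map_andThen_add μ c _).symm
    cases q with
    | tick c => exact (congrArg (PMF.map _) (ih ())).trans (hm _ c)
    | coin =>
      refine Eq.trans ?_ (bind_andThen _ _ _).symm
      exact congrArg _ (funext fun v => (congrArg (PMF.map _) (ih v)).trans (hm _ 1))
    | perm x => exact (congrArg (PMF.map _) (ih _)).trans (hm _ 1)
    | permInv x => exact (congrArg (PMF.map _) (ih _)).trans (hm _ 1)
    | abort =>
      show PMF.pure (none, 0) = (PMF.pure ((none, 0) : Option α × ℕ)).bind _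
      rw [PMF.pure_bind]

theorem idealSecond_ask {σ : Type} (P : Equiv.Perm (Word n × Word n))
    (ans : Term n → σ → SimProg n (Word n × σ)) (f : α → SecondPhase n)
    (p : OracleProg (Term n) (fun _ => Word n) α) (st : σ) :
    idealSecond P ans (FirstPhase.ask f p) st =
      andThen (idealFirst P ans p st) fun o => idealSecond P ans (f o.1) o.2 := by
  induction p generalizing st with
  | done a =>
    rw [idealFirst, pure_andThen]
    simp only [zero_add]
    exact (PMF.map_id _).symm
  | query t k ih =>
    rw [idealFirst, andThen_assoc, FirstPhase.ask, idealSecond]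
    simp only [ih]

end

/-! ### The first phase in the ideal world -/

section

variable {n : ℕ} {α : Type} (P : Equiv.Perm (Word n × Word n)) (R : PubRand n) (A : Subversion n)

theorem run_firstAnswer_of_some {t : Term n} {T : Table n} {y : Word n} (h : T.lookup t = some y) :
    (firstAnswer t T).run P = PMF.pure (some (y, T), 1) := by
  simp only [firstAnswer, liftedSimulator, h, SimProg.run, PMF.pure_map]

theorem run_firstAnswer_of_none {t : Term n} {T : Table n} (h : T.lookup t = none) :
    (firstAnswer t T).run P =
      (PMF.uniformOfFintype (Word n)).bind fun y => PMF.pure (some (y, (t, y) :: T), 2) := by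
  simp only [firstAnswer, liftedSimulator, h, SimProg.run, PMF.pure_map, PMF.map_bind]

/-- The first phase of the lifted simulator is never aborted, and its final table records its
transcript: at most one entry and two steps for each query. -/
theorem idealFirst_firstAnswer_support (p : OracleProg (Term n) (fun _ => Word n) α) (T : Table n) :
    ∀ o ∈ (idealFirst P firstAnswer p T).support, ∃ a T', o.1 = some (a, T') ∧
      Extends T T' ∧ Follows T' a p ∧ ((T.map Prod.fst).Nodup → (T'.map Prod.fst).Nodup) ∧
      ∀ post m, p.Within post m → T'.length ≤ T.length + m ∧ o.2 ≤ 2 * m := by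
  induction p generalizing T with
  | done a =>
    intro o ho
    rw [idealFirst, PMF.support_pure, Set.mem_singleton_iff] at ho
    subst ho
    exact ⟨a, T, rfl, fun _ _ h => h, rfl, id, fun _ _ _ => ⟨Nat.le_add_right _ _, Nat.zero_le _⟩⟩
  | query t k ih =>
    intro o ho
    rw [idealFirst] at ho
    cases h : T.lookup t with
    | some y =>
      rw [run_firstAnswer_of_some P h, pure_andThen, PMF.support_map] at ho
      obtain ⟨o, ho, rfl⟩ := ho
      obtain ⟨a, T', h1, h2, h3, h4, h5⟩ := ih _ _ o ho
      refine ⟨a, T', h1, h2, ⟨y, h2 _ _ h, h3⟩, h4, fun post m hm => ?_⟩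
      cases m with
      | zero => exact hm.elim
      | succ m =>
        have := h5 post m (hm y)
        dsimp only at this ⊢
        omega
    | none =>
      rw [run_firstAnswer_of_none P h, bind_andThen, PMF.mem_support_bind_iff] at ho
      obtain ⟨y, -, ho⟩ := ho
      rw [pure_andThen, PMF.support_map] at ho
      obtain ⟨o, ho, rfl⟩ := ho
      obtain ⟨a, T', h1, h2, h3, h4, h5⟩ := ih _ _ o ho
      have hext : Extends T ((t, y) :: T) := Extends.cons (fun _ _ h => h) h
      refine ⟨a, T', h1, fun t' y' h' => h2 _ _ (hext _ _ h'),
        ⟨y, h2 _ _ List.lookup_cons_self, h3⟩, fun hT => h4 ?_, fun post m hm => ?_⟩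
      · rw [List.map_cons, List.nodup_cons]
        refine ⟨fun hmem => ?_, hT⟩
        obtain ⟨e, he, rfl⟩ := List.mem_map.1 hmem
        obtain ⟨y', hy'⟩ := exists_lookup_of_mem he
        rw [hy'] at h
        cases h
      · cases m with
        | zero => exact hm.elim
        | succ m =>
          have := h5 post m (hm y)
          rw [List.length_cons] at this
          dsimp only
          omega

/-- The state of the simulator when it has recorded the table `T` without any long chain. -/
def SimState.quiet (T : Table n) : SimState n := ⟨T, [], [], []⟩

theorem Sim.inner_run (t : Term n) (st : SimState n) :
    Sim.inner R t st = .query (.tick 1) fun _ => (match st.table.lookup t with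
      | some y => pure y
      | none => do
        let y ← Sim.coin
        Sim.record R t y
        pure y : Sim.M n (Word n)) st := rfl

theorem Sim.emptyQueue_quiet (T : Table n) (fuel : ℕ) :
    Sim.emptyQueue R A (fuel + 1) (.quiet T) = .done ((), .quiet T) := rfl

theorem answer_eq (t : Term n) (st : SimState n) :
    secondAnswer t (R, A, st) = OracleProg.bind (OracleProg.bind (Sim.inner R t st)
      fun r => OracleProg.bind (Sim.emptyQueue R A (8 * n * 4 ^ n + 1) r.2)
        fun r' => .done (r.1, r'.2)) fun r => .done (r.1, R, A, r.2) := rfl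

theorem run_answer_of_some {t : Term n} {T : Table n} {y : Word n} (h : T.lookup t = some y) :
    SimProg.run P (secondAnswer t (R, A, .quiet T)) =
      PMF.pure (some (y, R, A, .quiet T), 1) := by
  have e : secondAnswer t (R, A, .quiet T) =
      .query (.tick 1) fun _ => .done (y, R, A, .quiet T) := by
    rw [answer_eq, Sim.inner_run, SimState.quiet, h]
    rfl
  rw [e, SimProg.run, SimProg.run, PMF.pure_map]

/-- Answering a new query, the simulator of the abbreviated model draws a uniform string `y`; if
this creates no long chain, the queue remains empty, and the simulator only records `y`. -/
theorem exists_run_answer_of_none {t : Term n} {T : Table n} (h : T.lookup t = none) :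
    ∃ g, SimProg.run P (secondAnswer t (R, A, .quiet T)) =
      (PMF.uniformOfFintype (Word n)).bind g ∧
      ∀ y, hasLongChain R ((t, y) :: T) = false →
        ∃ c, g y = PMF.pure (some (y, R, A, .quiet ((t, y) :: T)), c) := by
  have e : secondAnswer t (R, A, .quiet T) =
      .query (.tick 1) fun _ => .query .coin fun y =>
        .query (.tick (2 * (T.length + 1) * trigLen n + 1)) fun _ =>
          OracleProg.bind (OracleProg.bind (Sim.emptyQueue R A (8 * n * 4 ^ n + 1) ⟨(t, y) :: T,
            newChains R ((t, y) :: T) (t.1.val + 1) (R.affInv t.1 t.2), [], []⟩)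
              fun r' => .done (y, r'.2)) fun r => .done (r.1, R, A, r.2) := by
    rw [answer_eq, Sim.inner_run, SimState.quiet, h]
    rfl
  rw [e]
  refine ⟨_, by rw [SimProg.run, SimProg.run, PMF.map_bind], fun y hy => ?_⟩
  have e2 := Sim.emptyQueue_quiet R A ((t, y) :: T) (8 * n * 4 ^ n)
  rw [SimState.quiet] at e2
  rw [newChains_eq_nil hy, e2]
  simp only [OracleProg.bind, SimProg.run, PMF.pure_map]
  exact ⟨_, rfl⟩

/-- With the same random values, the simulator of the abbreviated model answers the queries
of the first phase as the lifted simulator, unless these contain a long chain; as tables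
only grow, it suffices to look for long chains at the end. -/
theorem coupled_idealFirst (p : OracleProg (Term n) (fun _ => Word n) α) (T : Table n) :
    Coupled (fun (o : Option (α × Table n) × ℕ)
        (o' : Option (α × RunState n) × ℕ) => ∃ a T',
        o.1 = some (a, T') ∧ (hasLongChain R T' = false → o'.1 = some (a, R, A, .quiet T')))
      (idealFirst P firstAnswer p T)
      (idealFirst P secondAnswer p (R, A, .quiet T)) := by
  induction p generalizing T with
  | done a => exact .pure ⟨a, T, rfl, fun _ => rfl⟩
  | query t k ih =>
    by_cases hT : hasLongChain R T = true
    · refine (Coupled.indep _ _).mono fun o ho o' _ _ => ?_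
      obtain ⟨a, T', h1, h2, -⟩ := idealFirst_firstAnswer_support P _ _ o ho
      exact ⟨a, T', h1, fun h => by rw [hasLongChain_mono h2 hT] at h; cases h⟩
    · show Coupled _
        (andThen ((firstAnswer t T).run P) fun r => idealFirst P firstAnswer (k r.1) r.2)
        (andThen (SimProg.run P (secondAnswer t (R, A, .quiet T))) fun r =>
          idealFirst P secondAnswer (k r.1) r.2)
      cases h : T.lookup t with
      | some y =>
        rw [run_firstAnswer_of_some P h, run_answer_of_some P R A h, pure_andThen, pure_andThen]
        exact (ih y T).map fun o o' h => h
      | none =>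
        obtain ⟨g, hg, hg'⟩ := exists_run_answer_of_none P R A h
        rw [run_firstAnswer_of_none P h, hg, bind_andThen, bind_andThen]
        refine Coupled.bind_same _ fun y => ?_
        by_cases hy : hasLongChain R ((t, y) :: T) = true
        · refine (Coupled.indep _ _).mono fun o ho o' _ _ => ?_
          rw [pure_andThen, PMF.support_map] at ho
          obtain ⟨o, ho, rfl⟩ := ho
          obtain ⟨a, T', h1, h2, -⟩ := idealFirst_firstAnswer_support P _ _ o ho
          exact ⟨a, T', h1, fun h => by rw [hasLongChain_mono h2 hy] at h; cases h⟩
        · obtain ⟨c, hc⟩ := hg' y (by simpa using hy)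
          rw [hc, pure_andThen, pure_andThen]
          exact (ih y _).map fun o o' h => h

theorem run_record (t : Term n) (y : Word n) (st : SimState n) :
    SimProg.run P (Sim.record R t y st) =
      PMF.pure (some ((), { st with
        table := (t, y) :: st.table
        queue := st.queue ++
          newChains R ((t, y) :: st.table) (t.1.val + 1) (R.affInv t.1 t.2) }),
        2 * (st.table.length + 1) * trigLen n + 1) := by
  show (PMF.pure _).map _ = _
  rw [PMF.pure_map]
  simp only [zero_add]
  rfl

/-- Replaying a table is deterministic.  The newest entry of a table with distinct terms extends the
older part, so that without a long chain at the end there is none in between either. -/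
theorem exists_run_replay (T : Table n) :
    ∃ st c, SimProg.run P (Sim.replay R T (.start n)) = PMF.pure (some ((), st), c) ∧
      st.table = T ∧ c ≤ T.length * (2 * T.length * trigLen n + 1) ∧
      ((T.map Prod.fst).Nodup → hasLongChain R T = false → st = .quiet T) := by
  induction T with
  | nil => exact ⟨.start n, 0, rfl, rfl, Nat.zero_le _, fun _ _ => rfl⟩
  | cons e T ih =>
    obtain ⟨st, c, h1, h2, h3, h4⟩ := ih
    have e1 : Sim.replay R (e :: T) (.start n) = OracleProg.bind (Sim.replay R T (.start n))
        fun r => Sim.record R e.1 e.2 r.2 := rfl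
    refine ⟨_, _, by rw [e1, run_bind, h1, pure_andThen, run_record, PMF.pure_map], ?_, ?_, ?_⟩
    · rw [h2]
    · rw [h2, List.length_cons]
      dsimp only
      nlinarith [h3]
    · intro hnd hl
      rw [List.map_cons, List.nodup_cons] at hnd
      have hext : Extends T (e :: T) := by
        refine Extends.cons (t := e.1) (y := e.2) (fun _ _ h => h) ?_
        refine List.lookup_eq_none_iff.2 fun e' he' => ?_
        rw [bne_iff_ne]
        exact fun h => hnd.1 (h ▸ List.mem_map_of_mem he')
      have hl' : hasLongChain R T = false := by
        by_contra h
        rw [hasLongChain_mono hext (by simpa using h)] at hl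
        cases hl
      rw [h4 hnd.2 hl', SimState.quiet, newChains_eq_nil (t := e.1) (y := e.2) hl]
      rfl

/-- A bound for the number of steps of the lifted simulator until the second phase, if the first
one has `q` queries. -/
def setupBound (n q : ℕ) : ℕ :=
  2 * q + (q * (2 * q * trigLen n + 1) + q ^ 2 * trigLen n)

theorem exists_run_setup (T : Table n) :
    ∃ c ≤ T.length * (2 * T.length * trigLen n + 1) + T.length ^ 2 * trigLen n,
      (hasLongChain R T = true →
        SimProg.run P (liftedSetup R A T) = PMF.pure (none, c)) ∧
      ((T.map Prod.fst).Nodup → hasLongChain R T = false →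
        SimProg.run P (liftedSetup R A T) =
          PMF.pure (some (R, A, .quiet T), c)) := by
  obtain ⟨st, c, h1, -, h3, h4⟩ := exists_run_replay P R T
  have e1 : liftedSetup R A T = OracleProg.bind (Sim.replay R T (.start n)) fun r =>
      .query (.tick (T.length ^ 2 * trigLen n)) fun _ =>
        if hasLongChain R T then .query .abort (fun y => nomatch y)
        else .done (R, A, r.2) := rfl
  refine ⟨c + T.length ^ 2 * trigLen n, Nat.add_le_add_right h3 _, fun h => ?_, fun hnd h => ?_⟩
  · rw [e1, run_bind, h1, pure_andThen, SimProg.run, if_pos h, SimProg.run, PMF.pure_map,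
      PMF.pure_map, zero_add]
  · rw [e1, run_bind, h1, pure_andThen, SimProg.run, if_neg (by simp [h]), SimProg.run,
      PMF.pure_map, PMF.pure_map, zero_add, h4 hnd h]

/-- The ideal world of the full model for given permutation and public randomness, with a flag
that tells whether the first phase ended with a long chain. -/
noncomputable def flaggedIdeal (p : FirstPhase n) : PMF (Bool × Option Bool × ℕ) :=
  (idealFirst P firstAnswer p []).bind fun o =>
    match o with
    | (none, c) => PMF.pure (false, none, c)
    | (some a, c) =>
      (andThen (SimProg.run P (liftedSetup R a.1.1 a.2)) fun st =>
        idealSecond P secondAnswer (a.1.2 R) st).map fun r =>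
          (hasLongChain R a.2, r.1, c + r.2)

theorem map_snd_flaggedIdeal (p : FirstPhase n) :
    (flaggedIdeal P R p).map Prod.snd =
      andThen (idealFirst P (liftedSimulator n).answer₁ p (liftedSimulator n).init) fun o =>
        andThen ((liftedSimulator n).setup R o.1.1 o.2 |>.run P) fun st =>
          idealSecond P (liftedSimulator n).answer₂ (o.1.2 R) st := by
  unfold flaggedIdeal andThen
  rw [PMF.map_bind]
  refine congrArg (PMF.bind _) (funext fun o => ?_)
  rcases o with ⟨_ | a, c⟩
  · simp only [PMF.pure_map]
  · simp only [PMF.map_comp]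
    rfl

theorem map_fst_flaggedIdeal (p : FirstPhase n) :
    (flaggedIdeal P R p).map Prod.fst =
      (idealFirst P firstAnswer p []).map fun o => o.1.any fun a => hasLongChain R a.2 := by
  unfold flaggedIdeal
  rw [PMF.map_bind]
  refine congrArg (PMF.bind _) (funext fun o => ?_)
  rcases o with ⟨_ | a, c⟩
  · rw [PMF.pure_map]; rfl
  · rw [PMF.map_comp]
    exact PMF.map_const _ _

/-- Unless the flag is raised, the two ideal worlds give the same decision; otherwise the
lifted simulator aborts.  In both cases its steps are those of the abbreviated model in the second
phase, and boundedly many before. -/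
theorem coupled_flaggedIdeal {p : FirstPhase n} {q : ℕ}
    {post : Subversion n × (PubRand n → SecondPhase n) → ℕ → Prop} (hp : p.Within post q) :
    Coupled (fun o o' => (o.1 = false → o.2.1 = o'.1) ∧ (o.1 = true → o.2.1 = none) ∧
        o.2.2 ≤ o'.2 + setupBound n q)
      (flaggedIdeal P R p)
      (idealSecond P secondAnswer (p.distinguisher (fun i => i.elim0) R)
        (R, p.subversion, .start n)) := by
  have e : idealSecond P secondAnswer (p.distinguisher (fun i => i.elim0) R)
        (R, p.subversion, .start n) =
      andThen (idealFirst P secondAnswer p (R, p.subversion, .quiet [])) fun o =>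
        idealSecond P secondAnswer (o.1.2 R) o.2 := idealSecond_ask _ _ _ _ _
  rw [e]
  have h := (coupled_idealFirst P R p.subversion p []).mono
    fun o ho o' _ h => And.intro h (idealFirst_firstAnswer_support P _ _ o ho)
  refine h.bind ?_
  rintro ⟨_, c⟩ ⟨o', c'⟩ ⟨⟨a, T, rfl, h1⟩, ⟨_, _, h2, -, h3, h4, h5⟩⟩
  cases h2
  obtain ⟨h5, h6⟩ := h5 post q hp
  have hnd := h4 List.nodup_nil
  rw [List.length_nil, zero_add] at h5
  obtain ⟨c1, hc1, hbad, hgood⟩ := exists_run_setup P R a.1 T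
  have hK : c + c1 ≤ setupBound n q := by
    have : T.length * (2 * T.length * trigLen n + 1) + T.length ^ 2 * trigLen n ≤
        q * (2 * q * trigLen n + 1) + q ^ 2 * trigLen n := by gcongr
    unfold setupBound
    dsimp only at h6
    omega
  dsimp only at h1 ⊢
  cases hl : hasLongChain R T with
  | true =>
    rw [hbad hl]
    have e2 : (andThen (PMF.pure ((none : Option (RunState n)), c1)) fun st =>
        idealSecond P secondAnswer (a.2 R) st) = PMF.pure (none, c1) :=
      PMF.pure_bind _ _
    rw [e2, PMF.pure_map]
    refine (Coupled.indep _ _).mono fun o ho o' _ _ => ?_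
    rw [PMF.support_pure, Set.mem_singleton_iff] at ho
    subst ho
    exact ⟨fun h => (nomatch h), fun _ => rfl, hK.trans (Nat.le_add_left _ _)⟩
  | false =>
    rw [hgood hnd hl, h1 hl, pure_andThen, PMF.map_comp]
    refine (coupled_idealSecond h3 P (a.2 R) (st := .quiet T) fun _ _ h => h).map ?_
    rintro ⟨o, d⟩ ⟨o', d'⟩ ⟨h7, h8⟩
    refine ⟨fun _ => ?_, fun h => by simp at h, ?_⟩
    · dsimp only at h7; cases h7 with
      | none => rfl
      | some h => rw [h]; rfl
    · simp only [Function.comp_apply] at h8 ⊢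
      omega

end

/-! ### Advantages and step counts of mixtures -/

section

variable {α β γ : Type}

theorem toOuterMeasure_le_one (μ : PMF α) (s : Set α) : μ.toOuterMeasure s ≤ 1 :=
  (μ.toOuterMeasure.mono (Set.subset_univ s)).trans
    (le_of_eq ((μ.toOuterMeasure_apply_eq_one_iff _).2 (Set.subset_univ _)))

theorem toOuterMeasure_ne_top (μ : PMF α) (s : Set α) : μ.toOuterMeasure s ≠ ⊤ :=
  ne_top_of_le_ne_top ENNReal.one_ne_top (toOuterMeasure_le_one μ s)

theorem toOuterMeasure_bind_le_add (μ : PMF α) {f : α → PMF β} {g : α → PMF γ} {s : Set β}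
    {t : Set γ} {e : ENNReal}
    (h : ∀ a, (f a).toOuterMeasure s ≤ (g a).toOuterMeasure t + e) :
    (μ.bind f).toOuterMeasure s ≤ (μ.bind g).toOuterMeasure t + e := by
  rw [PMF.toOuterMeasure_bind_apply, PMF.toOuterMeasure_bind_apply]
  calc _ ≤ ∑' a, (μ a * (g a).toOuterMeasure t + μ a * e) :=
        ENNReal.tsum_le_tsum fun a => by rw [← mul_add]; gcongr; exact h a
    _ = _ := by rw [ENNReal.tsum_add, ENNReal.tsum_mul_right, μ.tsum_coe, one_mul]

theorem toOuterMeasure_bind_le (μ : PMF α) {f : α → PMF β} {s : Set β} {e : ENNReal}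
    (h : ∀ a ∈ μ.support, (f a).toOuterMeasure s ≤ e) :
    (μ.bind f).toOuterMeasure s ≤ e := by
  rw [PMF.toOuterMeasure_bind_apply]
  calc _ ≤ ∑' a, μ a * e := ENNReal.tsum_le_tsum fun a => by
        by_cases ha : a ∈ μ.support
        · gcongr; exact h a ha
        · rw [(PMF.apply_eq_zero_iff _ _).2 ha, zero_mul, zero_mul]
    _ = _ := by rw [ENNReal.tsum_mul_right, μ.tsum_coe, one_mul]

/-- Randomness that is used only after a run may be drawn before it. -/
theorem andThen_bind_comm (μ : PMF (Option α × ℕ)) (ν : PMF γ)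
    (f : γ → α → PMF (Option β × ℕ)) :
    andThen μ (fun a => ν.bind fun c => f c a) = ν.bind fun c => andThen μ (f c) := by
  unfold andThen
  rw [PMF.bind_comm]
  congr 1
  funext o
  rcases o with ⟨_ | a, c⟩
  · exact (PMF.bind_const _ _).symm
  · exact PMF.map_bind _ _ _

/-- The event that the distinguisher outputs `1` in the ideal world. -/
def accepts : Set (Option Bool × ℕ) := {r | r.1 = some true}

theorem advantage_le_iff {real : PMF Bool} {ideal : PMF (Option Bool × ℕ)} {e : ℝ} (he : 0 ≤ e) :
    advantage real ideal ≤ e ↔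
      real.toOuterMeasure {true} ≤ ideal.toOuterMeasure accepts + ENNReal.ofReal e ∧
      ideal.toOuterMeasure accepts ≤ real.toOuterMeasure {true} + ENNReal.ofReal e := by
  have key : ∀ {a b : ENNReal}, a ≠ ⊤ → b ≠ ⊤ →
      (a.toReal - b.toReal ≤ e ↔ a ≤ b + ENNReal.ofReal e) := by
    intro a b ha hb
    rw [← ENNReal.toReal_le_toReal ha (ENNReal.add_ne_top.2 ⟨hb, ENNReal.ofReal_ne_top⟩),
      ENNReal.toReal_add hb ENNReal.ofReal_ne_top, ENNReal.toReal_ofReal he, sub_le_iff_le_add']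
  have h1 : real true = real.toOuterMeasure {true} := (PMF.toOuterMeasure_apply_singleton _ _).symm
  have h2 : (ideal.map Prod.fst) (some true) = ideal.toOuterMeasure accepts := by
    rw [← PMF.toOuterMeasure_apply_singleton, PMF.toOuterMeasure_map_apply]
    rfl
  rw [advantage, h1, h2, abs_sub_le_iff,
    key (toOuterMeasure_ne_top _ _) (toOuterMeasure_ne_top _ _),
    key (toOuterMeasure_ne_top _ _) (toOuterMeasure_ne_top _ _)]

theorem advantage_bind_le (μ : PMF α) {f : α → PMF Bool} {g : α → PMF (Option Bool × ℕ)} {e : ℝ}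
    (h : ∀ a, advantage (f a) (g a) ≤ e) : advantage (μ.bind f) (μ.bind g) ≤ e := by
  obtain ⟨a, -⟩ := μ.support_nonempty
  have he : 0 ≤ e := (abs_nonneg _).trans (h a)
  simp only [advantage_le_iff he] at h ⊢
  exact ⟨toOuterMeasure_bind_le_add μ fun a => (h a).1,
    toOuterMeasure_bind_le_add μ fun a => (h a).2⟩

theorem stepsExceed_bind_le (μ : PMF α) {g : α → PMF (Option Bool × ℕ)} {c : ℕ} {e : ℝ}
    (h : ∀ a, stepsExceed (g a) c ≤ e) : stepsExceed (μ.bind g) c ≤ e := by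
  obtain ⟨a, -⟩ := μ.support_nonempty
  have he : 0 ≤ e := ENNReal.toReal_nonneg.trans (h a)
  exact ENNReal.toReal_le_of_le_ofReal he (toOuterMeasure_bind_le μ fun a _ =>
    (ENNReal.le_ofReal_iff_toReal_le (toOuterMeasure_ne_top _ _) he).2 (h a))

end

/-! ### The reduction -/

section

variable {n : ℕ}

/-- The ideal world of the full model for a first phase without coins, with the flag of
`flaggedIdeal`. -/
noncomputable def flaggedGame (p : FirstPhase n) : PMF (Bool × Option Bool × ℕ) :=
  (PMF.uniformOfFintype (Fin 0 → Bool)).bind fun _ =>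
  (PMF.uniformOfFintype (Equiv.Perm (Word n × Word n))).bind fun P =>
  (PMF.uniformOfFintype (PubRand n)).bind fun R => flaggedIdeal P R p

theorem map_snd_flaggedGame (p : FirstPhase n) :
    (flaggedGame p).map Prod.snd = fullIdeal (m := 0) (liftedSimulator n) fun _ => p := by
  unfold flaggedGame fullIdeal
  simp only [PMF.map_bind, map_snd_flaggedIdeal, andThen_bind_comm]

variable {p : FirstPhase n} {q : ℕ}
  {post : Subversion n × (PubRand n → SecondPhase n) → ℕ → Prop}

/-- The flag is raised with probability at most `chainBound n q`: the terms of the first phase are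
chosen before the public randomness is drawn. -/
theorem flaggedGame_flag_le (hp : p.Within post q) :
    (flaggedGame p).toOuterMeasure {o | o.1 = true} ≤ ENNReal.ofReal (chainBound n q) := by
  refine toOuterMeasure_bind_le _ fun _ _ => toOuterMeasure_bind_le _ fun P _ => ?_
  have e : ∀ μ : PMF (Bool × Option Bool × ℕ), μ.toOuterMeasure {o | o.1 = true} =
      (μ.map Prod.fst).toOuterMeasure {true} := fun μ => by
    rw [PMF.toOuterMeasure_map_apply]; rfl
  rw [e, PMF.map_bind]
  simp only [map_fst_flaggedIdeal]
  unfold PMF.map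
  rw [PMF.bind_comm]
  refine toOuterMeasure_bind_le _ fun o ho => ?_
  obtain ⟨a, T, h1, -, -, -, h5⟩ := idealFirst_firstAnswer_support P p [] o ho
  have hT := (h5 post q hp).1
  rw [List.length_nil, zero_add] at hT
  refine le_trans (le_of_eq ?_) (prob_hasLongChain_le T hT)
  simp only [Function.comp_apply, h1, Option.any_some]
  exact PMF.toOuterMeasure_map_apply (fun R : PubRand n => hasLongChain R T)
    (PMF.uniformOfFintype (PubRand n)) {true}

theorem coupled_flaggedGame (hp : p.Within post q) :
    Coupled (fun o o' => (o.1 = false → o.2.1 = o'.1) ∧ (o.1 = true → o.2.1 = none) ∧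
        o.2.2 ≤ o'.2 + setupBound n q)
      (flaggedGame p) (abbrIdeal (chainSimulator n) p.distinguisher p.subversion) :=
  Coupled.bind_same _ fun _ => Coupled.bind_same _ fun P => Coupled.bind_same _ fun R =>
    coupled_flaggedIdeal P R hp

theorem fullIdeal_accepts_le (hp : p.Within post q) :
    (fullIdeal (m := 0) (liftedSimulator n) fun _ => p).toOuterMeasure accepts ≤
      (abbrIdeal (chainSimulator n) p.distinguisher p.subversion).toOuterMeasure accepts := by
  rw [← map_snd_flaggedGame, PMF.toOuterMeasure_map_apply]
  refine (coupled_flaggedGame hp).toOuterMeasure_le ?_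
  rintro ⟨_ | _, o⟩ o' ⟨h1, h2, -⟩ (ho : o.1 = some true)
  · exact (h1 rfl).symm.trans ho
  · rw [show o.1 = none from h2 rfl] at ho
    cases ho

theorem abbrIdeal_accepts_le (hp : p.Within post q) :
    (abbrIdeal (chainSimulator n) p.distinguisher p.subversion).toOuterMeasure accepts ≤
      (fullIdeal (m := 0) (liftedSimulator n) fun _ => p).toOuterMeasure accepts +
        ENNReal.ofReal (chainBound n q) := by
  obtain ⟨κ, h1, h2, h3⟩ := coupled_flaggedGame hp
  rw [← map_snd_flaggedGame]
  refine le_trans ?_ (add_le_add_right (flaggedGame_flag_le hp) _)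
  rw [← h1, ← h2, PMF.map_comp, PMF.toOuterMeasure_map_apply, PMF.toOuterMeasure_map_apply,
    PMF.toOuterMeasure_map_apply]
  refine le_trans (PMF.toOuterMeasure_mono _ ?_) (MeasureTheory.measure_union_le _ _)
  rintro ⟨⟨_ | _, o⟩, o'⟩ ⟨ho, hx⟩
  · exact Or.inl (((h3 _ hx).1 rfl).trans ho)
  · exact Or.inr rfl

theorem stepsExceed_fullIdeal_le (hp : p.Within post q) (c : ℕ) :
    stepsExceed (fullIdeal (m := 0) (liftedSimulator n) fun _ => p) (c + setupBound n q) ≤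
      stepsExceed (abbrIdeal (chainSimulator n) p.distinguisher p.subversion) c := by
  unfold stepsExceed
  rw [← map_snd_flaggedGame, PMF.toOuterMeasure_map_apply]
  refine ENNReal.toReal_mono (toOuterMeasure_ne_top _ _)
    ((coupled_flaggedGame hp).toOuterMeasure_le ?_)
  rintro o o' ⟨-, -, h⟩ (ho : c + setupBound n q < o.2.2)
  show c < o'.2
  omega

theorem advantage_full_le (hp : p.Within post q) {e : ℝ}
    (h : advantage (abbrReal p.distinguisher p.subversion)
      (abbrIdeal (chainSimulator n) p.distinguisher p.subversion) ≤ e) :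
    advantage (fullReal (m := 0) fun _ => p) (fullIdeal (m := 0) (liftedSimulator n) fun _ => p) ≤
      e + chainBound n q := by
  have he : 0 ≤ e := (abs_nonneg _).trans h
  have hc := chainBound_nonneg n q
  rw [advantage_le_iff he, FirstPhase.abbrReal_distinguisher] at h
  rw [advantage_le_iff (add_nonneg he hc), ENNReal.ofReal_add he hc]
  constructor
  · calc _ ≤ _ := h.1
      _ ≤ _ := add_le_add_left (abbrIdeal_accepts_le hp) _
      _ = _ := by rw [add_assoc, add_comm (ENNReal.ofReal (chainBound n q))]
  · calc _ ≤ _ := fullIdeal_accepts_le hp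
      _ ≤ _ := h.2
      _ ≤ _ := by rw [← add_assoc]; exact le_self_add

theorem fullReal_eq_bind {m : ℕ} (D : FullDistinguisher n m) :
    fullReal D = (PMF.uniformOfFintype (Fin m → Bool)).bind fun u =>
      fullReal (m := 0) fun _ => D u := by
  unfold fullReal
  simp only [PMF.bind_const]

theorem fullIdeal_eq_bind {m : ℕ} (S : FullSimulator n) (D : FullDistinguisher n m) :
    fullIdeal S D = (PMF.uniformOfFintype (Fin m → Bool)).bind fun u =>
      fullIdeal (m := 0) S fun _ => D u := by
  unfold fullIdeal
  simp only [PMF.bind_const]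

theorem setupBound_le {n q x : ℕ} (hn : n ≤ x) (hq : q ≤ x) :
    setupBound n q ≤ 2 * x + (x * (2 * x * (x + 2) + 1) + x ^ 2 * (x + 2)) := by
  have ht : trigLen n ≤ x + 2 := by unfold trigLen; omega
  unfold setupBound
  gcongr

theorem eval_le_eval (f : Polynomial ℕ) {x y : ℕ} (h : x ≤ y) : f.eval x ≤ f.eval y := by
  rw [Polynomial.eval_eq_sum, Polynomial.eval_eq_sum]
  exact Finset.sum_le_sum fun i _ => Nat.mul_le_mul_left _ (Nat.pow_le_pow_left h i)

theorem stepsExceed_anti (μ : PMF (Option Bool × ℕ)) {c c' : ℕ} (h : c ≤ c') :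
    stepsExceed μ c' ≤ stepsExceed μ c :=
  ENNReal.toReal_mono (toOuterMeasure_ne_top _ _)
    (μ.toOuterMeasure.mono fun _ hr => lt_of_le_of_lt h hr)

end

theorem mainTheorem3 (qD qA : ℕ → ℕ) (ε ε' : ℕ → ℝ)
    (h : AbbrCrookedIndifferentiable chainSimulator qD (fun n => qA n + qD n) ε ε') :
    CrookedIndifferentiable liftedSimulator qD qA ε (fun n =>
      ε' n + 8 * (n : ℝ) * (qD n : ℝ) ^ ((n : ℝ) / 10) *
        (2 : ℝ) ^ (2 * (n : ℝ) - (n : ℝ) ^ 2 / 10)) := by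
  obtain ⟨⟨f, ν, hν, hsteps⟩, hadv⟩ := h
  -- The argument doubles because the subversion algorithm of the abbreviated model makes `qA + qD`
  -- queries; the second summand bounds `setupBound`.
  refine ⟨⟨f.comp (2 * .X) + (2 * .X + (.X * (2 * .X * (.X + 2) + 1) + .X ^ 2 * (.X + 2))), ν, hν,
    fun n m D hD => ?_⟩, fun n m D hD => ?_⟩
  · rw [fullIdeal_eq_bind]
    refine stepsExceed_bind_le _ fun u => ?_
    refine le_trans (stepsExceed_anti _ ?_) <| (stepsExceed_fullIdeal_le (hD u) _).trans <|
      hsteps n 0 _ _ (FirstPhase.atMost_distinguisher (hD u))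
        (FirstPhase.admissible_subversion (hD u))
    rw [Polynomial.eval_add]
    refine add_le_add ?_ ?_
    · rw [Polynomial.eval_comp]
      refine eval_le_eval f ?_
      simp only [Polynomial.eval_mul, Polynomial.eval_X, Polynomial.eval_ofNat]
      omega
    · refine (setupBound_le (x := n + qD n + qA n) (by omega) (by omega)).trans (le_of_eq ?_)
      simp
  · rw [fullReal_eq_bind, fullIdeal_eq_bind]
    refine advantage_bind_le _ fun u => ?_
    exact advantage_full_le (hD u) (hadv n 0 _ _ (FirstPhase.atMost_distinguisher (hD u))
      (FirstPhase.admissible_subversion (hD u)))
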